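/- Let $H=\begin{pmatrix}a&b\\ b&c\end{pmatrix}$ be a trace normed Hamiltonian on $[0,\infty)$: $a,b,c$ are real-valued and locally integrable on $[0,\infty)$, $H(x)\ge 0$ and $\operatorname{tr}H(x)=a(x)+c(x)=1$ for almost all $x\ge 0$, and it is not the case that $b(x)=c(x)=0$ for almost all $x$. Let $J=\begin{pmatrix}0&-1\\ 1&0\end{pmatrix}$, let $U(z,\cdot)$ be the matrix solution of $JU'=zHU$ on $[0,\infty)$ with $U(z,0)=I_2$, and let $m:\mathbb C\setminus\mathbb R\to\mathbb C$ be the $m$-function of $H$, that is, for every $z\in\mathbb C\setminus\mathbb R$ the function $Y=U(z,\cdot)\binom{1}{m(z)}$ satisfies $\int_0^\infty Y(x)^*H(x)Y(x)\,dx<\infty$. Put $A(x)=\int_0^x a(t)\,dt$ and $C(x)=\int_0^x c(t)\,dt$. A non-decreasing function $h:(0,\infty)\to(0,\infty)$ is called rapidly varying at $0$ if $\lim_{t\downarrow 0}h(xt)/h(t)=\infty$ for every $x>1$. (a) If $A$ is rapidly varying at $0$, let $F:(0,\infty)\to(0,\infty)$ be the inverse of $x\mapsto 1/(xA(x))$ and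 $f(r)=rF(r^2)$ for $r>0$. Then $$m(r\mu)=-\frac{1}{\mu f(r)}\,(1+o(1)),\qquad r\to\infty .$$ (b) If $C$ is rapidly varying at $0$, let $G:(0,\infty)\to(0,\infty)$ be the inverse of $x\mapsto 1/(xC(x))$ and $g(r)=rG(r^2)$ for $r>0$. Then $$m(r\mu)=\mu\, g(r)\,(1+o(1)),\qquad r\to\infty .$$ In both cases the estimate holds uniformly for $\mu$ in any compact subset of $\mathbb C$ not intersecting the real line. -/

import Mathlib

open Set Filter Topology MeasureTheory

noncomputable section

namespace CanonicalSystem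

/-- A Hamiltonian on `[0, ∞)`: entries `H x 0 0 = a x`, `H x 0 1 = H x 1 0 = b x`, `H x 1 1 = c x`.
`PosSemidef` contains the symmetry of `H x`; the fourth condition is the limit-point condition at
`∞`, the last one excludes `b = c = 0` almost everywhere. -/
structure IsHamiltonian (H : ℝ → Matrix (Fin 2) (Fin 2) ℝ) : Prop where
  locallyIntegrable : ∀ i j, LocallyIntegrableOn (fun x => H x i j) (Ici 0)
  posSemidef : ∀ᵐ x ∂(volume.restrict (Ici (0 : ℝ))), (H x).PosSemidef
  ne_zero : ∀ᵐ x ∂(volume.restrict (Ici (0 : ℝ))), H x ≠ 0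
  lintegral_trace : ∫⁻ x in Ici (0 : ℝ), ENNReal.ofReal (H x).trace = ⊤
  nondegenerate : ¬ ∀ᵐ x ∂(volume.restrict (Ici (0 : ℝ))), H x 0 1 = 0 ∧ H x 1 1 = 0

/-- `tr H(x) = 1` for almost all `x ∈ [0, ∞)`. -/
def IsTraceNormed (H : ℝ → Matrix (Fin 2) (Fin 2) ℝ) : Prop :=
  ∀ᵐ x ∂(volume.restrict (Ici (0 : ℝ))), (H x).trace = 1

/-- The symplectic matrix `J`. -/
def J : Matrix (Fin 2) (Fin 2) ℂ := !![0, -1; 1, 0]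

/-- The real matrix `H x`, seen as a complex matrix. -/
def toComplex (M : Matrix (Fin 2) (Fin 2) ℝ) : Matrix (Fin 2) (Fin 2) ℂ :=
  M.map (fun s : ℝ => (s : ℂ))

/-- `U` is the fundamental matrix solution of `J Y' = z H Y` on `[0, ∞)` with `U z 0 = 1`.
The differential equation for locally absolutely continuous functions is written in its
integrated form `J U(z,x) - J U(z,0) = z ∫₀ˣ H(t) U(z,t) dt`, entry by entry. -/
def IsFundamentalSolution (H : ℝ → Matrix (Fin 2) (Fin 2) ℝ)
    (U : ℂ → ℝ → Matrix (Fin 2) (Fin 2) ℂ) : Prop :=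
  ∀ z : ℂ, ContinuousOn (U z) (Ici 0) ∧ U z 0 = 1 ∧
    ∀ x : ℝ, 0 ≤ x → ∀ i j : Fin 2,
      (J * U z x) i j - (J * U z 0) i j = z * ∫ t in (0 : ℝ)..x, (toComplex (H t) * U z t) i j

/-- `Y ∈ L²([0, ∞); H)`, that is, `∫₀^∞ Y(x)^* H(x) Y(x) dx < ∞`. -/
def MemL2 (H : ℝ → Matrix (Fin 2) (Fin 2) ℝ) (Y : ℝ → Fin 2 → ℂ) : Prop :=
  IntegrableOn (fun x => star (Y x) ⬝ᵥ Matrix.mulVec (toComplex (H x)) (Y x)) (Ici (0 : ℝ))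

/-- `m` is the `m`-function (Weyl function) of the canonical system with Hamiltonian `H`: for each
non-real `z`, the solution with initial value `(1, m z)` belongs to `L²([0, ∞); H)`.
The values of `m` on the real line are irrelevant. -/
def IsMFunction (H : ℝ → Matrix (Fin 2) (Fin 2) ℝ) (m : ℂ → ℂ) : Prop :=
  ∃ U : ℂ → ℝ → Matrix (Fin 2) (Fin 2) ℂ, IsFundamentalSolution H U ∧
    ∀ z : ℂ, z.im ≠ 0 → MemL2 H (fun x => Matrix.mulVec (U z x) ![1, m z])

/-- `A(x) = ∫₀ˣ a(t) dt`. -/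
def intA (H : ℝ → Matrix (Fin 2) (Fin 2) ℝ) (x : ℝ) : ℝ := ∫ t in (0 : ℝ)..x, H t 0 0

/-- `C(x) = ∫₀ˣ c(t) dt`. -/
def intC (H : ℝ → Matrix (Fin 2) (Fin 2) ℝ) (x : ℝ) : ℝ := ∫ t in (0 : ℝ)..x, H t 1 1

/-- The restriction of `A` to `(0, ∞)` is a non-decreasing function `(0, ∞) → (0, ∞)` that is
rapidly varying at `0`. -/
def IsRapidlyVaryingAtZero (A : ℝ → ℝ) : Prop :=
  MonotoneOn A (Ioi 0) ∧ (∀ x, 0 < x → 0 < A x) ∧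
    ∀ x : ℝ, 1 < x → Tendsto (fun t => A (x * t) / A t) (𝓝[>] 0) atTop

/-- The inverse of the function `x ↦ 1 / (x A(x))` on `(0, ∞)`. For a positive, continuous,
non-decreasing `A` on `(0, ∞)` with limit `0` at `0`, that function is a bijection of `(0, ∞)`. -/
def scaleInv (A : ℝ → ℝ) : ℝ → ℝ :=
  Function.invFunOn (fun x => 1 / (x * A x)) (Ioi 0)

/-- `f(r) = r F(r²)`, where `F` is the inverse of `x ↦ 1 / (x A(x))`. -/
def scaleFun (A : ℝ → ℝ) (r : ℝ) : ℝ := r * scaleInv A (r ^ 2)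

end CanonicalSystem

end

/-! Write a solution as `(u, v)`, put `x₀ = F(r²)` and `A₀ = A(x₀)`, so that `r² x₀ A₀ = 1` and
`f(r) = r x₀`. Rapid variation makes `A` look like a wall at `x₀`: slightly to the left it is far
below `A₀`, slightly to the right far above. Left of the wall `a` is negligible, hence so is `b` (as
`b² ≤ ac`), and `c` is nearly `1`: the system is nearly that of `diag(0, 1)`, where `v` is constant
and `u(x₀) ≈ u(0) + z x₀ v(0)`. At the wall a large mass of `a` sits on a very short interval, and a
solution of small energy must have small `u` there. Thus `u(0) + z x₀ v(0) ≈ 0`; with `z = rμ`,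
`u(0) = 1`, `v(0) = m(rμ)` this reads `1 + μ f(r) m(rμ) ≈ 0`, which is (a).

The energy bound is `IsSolution.integral_energy_le`: a finite-energy solution has total energy at
most the Wronskian of its initial data divided by `Im z`. Increments of `u` and `v` are then
controlled by Cauchy–Schwarz. `norm_fst_sub_linear_le` treats the region before the wall,
`exists_norm_fst_le` the wall, and `IsSolution.norm_initial_le` joins them into an error with an
explicit constant. Since this constant depends only on bounds for `‖μ‖` and `|Im μ|`, the estimate
is uniform on compacta.

Part (b) is the same estimate for the rotated solution `(v, -u)`, whose Hamiltonian has `a` and `c`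
exchanged. -/

noncomputable section

namespace CanonicalSystem

/-! ### Product rule and Cauchy–Schwarz for integrals -/

/-- Product rule for primitives of integrable functions. -/
theorem mul_sub_mul_eq_integral {f g f' g' : ℝ → ℝ} {X : ℝ} (hX : 0 ≤ X)
    (hf' : IntervalIntegrable f' volume 0 X) (hg' : IntervalIntegrable g' volume 0 X)
    (hf : ∀ x ∈ Icc 0 X, f x = f 0 + ∫ t in (0 : ℝ)..x, f' t)
    (hg : ∀ x ∈ Icc 0 X, g x = g 0 + ∫ t in (0 : ℝ)..x, g' t) :
    f X * g X - f 0 * g 0 = ∫ t in (0 : ℝ)..X, (f' t * g t + f t * g' t) := by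
  -- The hypotheses describe `f` and `g` only on `[0, X]`, so the product rule is applied to the
  -- absolutely continuous primitives and transferred back.
  have ac : ∀ {h : ℝ → ℝ} (k : ℝ), IntervalIntegrable h volume 0 X →
      AbsolutelyContinuousOnInterval (fun x => k + ∫ t in (0 : ℝ)..x, h t) 0 X := by
    intro h k hh
    have h0 : AbsolutelyContinuousOnInterval (fun _ : ℝ => k) 0 X :=
      ((LipschitzWith.const k).lipschitzOnWith (s := uIcc 0 X)).absolutelyContinuousOnInterval
    exact h0.fun_add (hh.absolutelyContinuousOnInterval_intervalIntegral (by simp))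
  have key := (ac (f 0) hf').integral_deriv_mul_eq_sub (ac (g 0) hg')
  rw [← hf X ⟨hX, le_rfl⟩, ← hg X ⟨hX, le_rfl⟩] at key
  simp only [intervalIntegral.integral_same, add_zero] at key
  rw [← key]
  apply intervalIntegral.integral_congr_ae
  filter_upwards [hf'.ae_hasDerivAt_integral, hg'.ae_hasDerivAt_integral] with x h1 h2 hx
  have hx' : x ∈ uIcc 0 X := uIoc_subset_uIcc hx
  have hxI : x ∈ Icc 0 X := by rwa [uIcc_of_le hX] at hx'
  rw [((h1 hx' 0 (by simp)).const_add (f 0)).deriv, ((h2 hx' 0 (by simp)).const_add (g 0)).deriv,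
    ← hf x hxI, ← hg x hxI]

/-- Cauchy–Schwarz inequality in the form `‖∫ g‖² ≤ (∫ p) (∫ q)` whenever `‖g‖² ≤ p q`. -/
theorem norm_integral_sq_le {g : ℝ → ℂ} {p q : ℝ → ℝ} {s t : ℝ} (hst : s ≤ t)
    (hg : IntervalIntegrable g volume s t) (hp : IntervalIntegrable p volume s t)
    (hq : IntervalIntegrable q volume s t)
    (h : ∀ᵐ x ∂volume.restrict (Icc s t), 0 ≤ p x ∧ 0 ≤ q x ∧ ‖g x‖ ^ 2 ≤ p x * q x) :
    ‖∫ x in s..t, g x‖ ^ 2 ≤ (∫ x in s..t, p x) * ∫ x in s..t, q x := by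
  have h1 : ‖∫ x in s..t, g x‖ ≤ ∫ x in s..t, ‖g x‖ :=
    intervalIntegral.norm_integral_le_integral_norm hst
  -- The quadratic `p l² - 2‖g‖ l + q` is pointwise nonnegative in `l`; after integration its
  -- discriminant is nonpositive.
  have h2 : discrim (∫ x in s..t, p x) (-2 * ∫ x in s..t, ‖g x‖) (∫ x in s..t, q x) ≤ 0 := by
    apply discrim_le_zero
    intro l
    have e : (∫ x in s..t, p x) * (l * l) + (-2 * ∫ x in s..t, ‖g x‖) * l + ∫ x in s..t, q x
        = ∫ x in s..t, (p x * (l * l) + ‖g x‖ * (-2 * l) + q x) := by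
      rw [intervalIntegral.integral_add ((hp.mul_const _).add (hg.norm.mul_const _)) hq,
        intervalIntegral.integral_add (hp.mul_const _) (hg.norm.mul_const _),
        intervalIntegral.integral_mul_const, intervalIntegral.integral_mul_const]
      ring
    rw [e]
    apply intervalIntegral.integral_nonneg_of_ae_restrict hst
    filter_upwards [h] with x ⟨hp0, hq0, hx⟩
    simp only [Pi.zero_apply]
    rcases hp0.eq_or_lt with h0 | h0
    · have : ‖g x‖ = 0 := by
        rw [← h0, zero_mul] at hx
        exact pow_eq_zero_iff two_ne_zero |>.1 (le_antisymm hx (sq_nonneg _))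
      rw [this, ← h0]; simpa using hq0
    · refine nonneg_of_mul_nonneg_right ?_ h0
      nlinarith [sq_nonneg (p x * l - ‖g x‖)]
  rw [discrim] at h2
  have h3 : 0 ≤ ‖∫ x in s..t, g x‖ := norm_nonneg _
  nlinarith [pow_le_pow_left₀ h3 h1 2]

/-! ### The system in scalar form -/

/-- The entries of a trace normed Hamiltonian `!![a, b; b, c]` on `[0, ∞)`. -/
structure IsTraceNormedTriple (a b c : ℝ → ℝ) : Prop where
  fst : LocallyIntegrableOn a (Ici 0)
  mid : LocallyIntegrableOn b (Ici 0)
  snd : LocallyIntegrableOn c (Ici 0)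
  bounds : ∀ᵐ t ∂volume.restrict (Ici (0 : ℝ)),
    0 ≤ a t ∧ 0 ≤ c t ∧ b t ^ 2 ≤ a t * c t ∧ a t + c t = 1

/-- `(u, v)` solves the canonical system with Hamiltonian `!![a, b; b, c]` and spectral
parameter `z`, in integrated form. -/
structure IsSolution (a b c : ℝ → ℝ) (z : ℂ) (u v : ℝ → ℂ) : Prop where
  cont_fst : ContinuousOn u (Ici 0)
  cont_snd : ContinuousOn v (Ici 0)
  fst : ∀ x, 0 ≤ x → u x - u 0 = z * ∫ t in (0 : ℝ)..x, (b t * u t + c t * v t)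
  snd : ∀ x, 0 ≤ x → v x - v 0 = -z * ∫ t in (0 : ℝ)..x, (a t * u t + b t * v t)

/-- The quadratic form `Y^* H Y` of the vector `Y = (u, v)`. -/
def energy (a b c : ℝ → ℝ) (u v : ℝ → ℂ) (t : ℝ) : ℝ :=
  a t * ‖u t‖ ^ 2 + 2 * b t * ((u t).re * (v t).re + (u t).im * (v t).im) + c t * ‖v t‖ ^ 2

theorem intervalIntegrable_ofReal_mul {a : ℝ → ℝ} {u : ℝ → ℂ}
    (ha : LocallyIntegrableOn a (Ici 0)) (hu : ContinuousOn u (Ici 0)) {s t : ℝ} (hs : 0 ≤ s)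
    (ht : 0 ≤ t) : IntervalIntegrable (fun x => (a x : ℂ) * u x) volume s t := by
  have hsub : uIcc s t ⊆ Ici (0 : ℝ) := fun x hx => (le_min hs ht).trans hx.1
  have h1 : IntervalIntegrable a volume s t :=
    (ha.integrableOn_compact_subset hsub isCompact_uIcc).intervalIntegrable
  have h2 : IntervalIntegrable (fun x => (a x : ℂ)) volume s t := ⟨h1.1.ofReal, h1.2.ofReal⟩
  exact h2.mul_continuousOn (hu.mono hsub)

theorem intervalIntegrable_of_nonneg {a : ℝ → ℝ}
    (ha : LocallyIntegrableOn a (Ici 0)) {s t : ℝ} (hs : 0 ≤ s)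
    (ht : 0 ≤ t) : IntervalIntegrable a volume s t :=
  (ha.integrableOn_compact_subset (fun _ hx => (le_min hs ht).trans hx.1)
    isCompact_uIcc).intervalIntegrable

theorem intervalIntegrable_mul {a : ℝ → ℝ} {u : ℝ → ℝ}
    (ha : LocallyIntegrableOn a (Ici 0)) (hu : ContinuousOn u (Ici 0)) {s t : ℝ} (hs : 0 ≤ s)
    (ht : 0 ≤ t) : IntervalIntegrable (fun x => a x * u x) volume s t :=
  (intervalIntegrable_of_nonneg ha hs ht).mul_continuousOn
    (hu.mono fun _ hx => (le_min hs ht).trans hx.1)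

theorem ae_Icc_of_ae_Ici {P : ℝ → Prop} (h : ∀ᵐ x ∂volume.restrict (Ici (0 : ℝ)), P x) {s t : ℝ}
    (hs : 0 ≤ s) : ∀ᵐ x ∂volume.restrict (Icc s t), P x :=
  ae_restrict_of_ae_restrict_of_subset (fun _ hx => hs.trans hx.1) h

/-! ### Inequalities for a single nonnegative matrix -/

section Pointwise

variable {a b c : ℝ} {u v : ℂ}

/-- The difference of the two sides is `(ac - b²)‖v‖²`. With its companion for the second row, this
lets the energy control both components of `H Y`, hence the derivatives of a solution. -/
theorem sq_norm_fst_le (hb : b ^ 2 ≤ a * c) :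
    ‖(a : ℂ) * u + b * v‖ ^ 2
      ≤ a * (a * ‖u‖ ^ 2 + 2 * b * (u.re * v.re + u.im * v.im) + c * ‖v‖ ^ 2) := by
  simp only [Complex.sq_norm, Complex.normSq_apply, Complex.add_re, Complex.add_im, Complex.mul_re,
    Complex.mul_im, Complex.ofReal_re, Complex.ofReal_im]
  nlinarith [mul_le_mul_of_nonneg_right hb (add_nonneg (mul_self_nonneg v.re)
    (mul_self_nonneg v.im))]

theorem sq_norm_snd_le (hb : b ^ 2 ≤ a * c) :
    ‖(b : ℂ) * u + c * v‖ ^ 2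
      ≤ c * (a * ‖u‖ ^ 2 + 2 * b * (u.re * v.re + u.im * v.im) + c * ‖v‖ ^ 2) := by
  simp only [Complex.sq_norm, Complex.normSq_apply, Complex.add_re, Complex.add_im, Complex.mul_re,
    Complex.mul_im, Complex.ofReal_re, Complex.ofReal_im]
  nlinarith [mul_le_mul_of_nonneg_right hb (add_nonneg (mul_self_nonneg u.re)
    (mul_self_nonneg u.im))]

theorem form_nonneg (ha : 0 ≤ a) (hc : 0 ≤ c) (hb : b ^ 2 ≤ a * c) :
    0 ≤ a * ‖u‖ ^ 2 + 2 * b * (u.re * v.re + u.im * v.im) + c * ‖v‖ ^ 2 := by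
  have h1 := (sq_nonneg _).trans (sq_norm_fst_le (u := u) (v := v) hb)
  have h2 := (sq_nonneg _).trans (sq_norm_snd_le (u := u) (v := v) hb)
  rcases ha.eq_or_lt with h | h
  · rcases hc.eq_or_lt with h' | h'
    · have : b = 0 := by
        rw [← h, zero_mul] at hb
        exact pow_eq_zero_iff two_ne_zero |>.1 (le_antisymm hb (sq_nonneg _))
      simp [← h, ← h', this]
    · exact nonneg_of_mul_nonneg_right h2 h'
  · exact nonneg_of_mul_nonneg_right h1 h

/-- The slack is exactly the form evaluated at `(u, 2v)`. The lemma recovers `a‖u‖²` from the energy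
without the mixed term. -/
theorem fst_mul_sq_le (ha : 0 ≤ a) (hc : 0 ≤ c) (hb : b ^ 2 ≤ a * c) :
    a * ‖u‖ ^ 2 ≤ 2 * (a * ‖u‖ ^ 2 + 2 * b * (u.re * v.re + u.im * v.im) + c * ‖v‖ ^ 2)
      + 2 * (c * ‖v‖ ^ 2) := by
  have h := form_nonneg (u := u) (v := 2 * v) ha hc hb
  simp only [norm_mul, Complex.mul_re, Complex.mul_im, Complex.re_ofNat, Complex.im_ofNat,
    Complex.norm_ofNat] at h
  nlinarith

/-- A lower bound for the quadratic form of a matrix of trace one. -/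
theorem sq_wronskian_le (ha : 0 ≤ a) (hc : 0 ≤ c) (hb : b ^ 2 ≤ a * c) (htr : a + c = 1) :
    (u.im * v.re - u.re * v.im) ^ 2
      ≤ (a * ‖u‖ ^ 2 + 2 * b * (u.re * v.re + u.im * v.im) + c * ‖v‖ ^ 2)
        * (‖u‖ ^ 2 + ‖v‖ ^ 2) := by
  set E := u.im * v.re - u.re * v.im with hE
  set q := a * ‖u‖ ^ 2 + 2 * b * (u.re * v.re + u.im * v.im) + c * ‖v‖ ^ 2 with hq
  have hq0 : 0 ≤ q := form_nonneg ha hc hb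
  have key : ∀ {d n : ℝ}, 0 ≤ d → 0 ≤ n → (d * E) ^ 2 ≤ (d * q) * n → d * E ^ 2 ≤ q * n := by
    intro d n hd hn h
    rcases hd.eq_or_lt with h0 | h0
    · rw [← h0, zero_mul]; positivity
    · refine le_of_mul_le_mul_left ?_ h0
      nlinarith
  have cs : ∀ x y : ℂ, (x.im * y.re - x.re * y.im) ^ 2 ≤ ‖x‖ ^ 2 * ‖y‖ ^ 2 := by
    intro x y
    simp only [Complex.sq_norm, Complex.normSq_apply]
    nlinarith [sq_nonneg (x.re * y.re + x.im * y.im)]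
  -- Adding a multiple of `v` to the first entry does not change the Wronskian with `v`, so `a E` is
  -- the Wronskian of the first row of `H Y` with `v`. The bound for `c` is analogous, and `a + c =
  -- 1` adds them up.
  have h1 : a * E ^ 2 ≤ q * ‖v‖ ^ 2 := by
    refine key ha (sq_nonneg _) ?_
    calc (a * E) ^ 2 = (((a : ℂ) * u + b * v).im * v.re - ((a : ℂ) * u + b * v).re * v.im) ^ 2 := by
          simp [hE]; ring
      _ ≤ _ := (cs _ _).trans (mul_le_mul_of_nonneg_right (sq_norm_fst_le hb) (sq_nonneg _))
  have h2 : c * E ^ 2 ≤ q * ‖u‖ ^ 2 := by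
    refine key hc (sq_nonneg _) ?_
    calc (c * E) ^ 2 = (((b : ℂ) * u + c * v).im * u.re - ((b : ℂ) * u + c * v).re * u.im) ^ 2 := by
          simp [hE]; ring
      _ ≤ _ := (cs _ _).trans (mul_le_mul_of_nonneg_right (sq_norm_snd_le hb) (sq_nonneg _))
  have : E ^ 2 = a * E ^ 2 + c * E ^ 2 := by rw [← add_mul, htr, one_mul]
  linarith

end Pointwise


/-! ### Integrals of the coefficients and of the energy -/

section

variable {a b c : ℝ → ℝ} {z : ℂ} {u v : ℝ → ℂ}

theorem intervalIntegrable_energy (h : IsTraceNormedTriple a b c) (hu : ContinuousOn u (Ici 0))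
    (hv : ContinuousOn v (Ici 0)) {s t : ℝ} (hs : 0 ≤ s) (ht : 0 ≤ t) :
    IntervalIntegrable (energy a b c u v) volume s t := by
  have hre : ∀ {w : ℝ → ℂ}, ContinuousOn w (Ici 0) → ContinuousOn (fun x => (w x).re) (Ici 0) :=
    fun hw => Complex.continuous_re.comp_continuousOn hw
  have him : ∀ {w : ℝ → ℂ}, ContinuousOn w (Ici 0) → ContinuousOn (fun x => (w x).im) (Ici 0) :=
    fun hw => Complex.continuous_im.comp_continuousOn hw
  have h1 := intervalIntegrable_mul h.fst (hu.norm.pow 2) hs ht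
  have h2 := intervalIntegrable_mul h.mid (((hre hu).mul (hre hv)).add ((him hu).mul (him hv)))
    hs ht
  have h3 := intervalIntegrable_mul h.snd (hv.norm.pow 2) hs ht
  refine ((h1.add (h2.const_mul 2)).add h3).congr fun x _ => ?_
  simp only [energy, Pi.add_apply, Pi.mul_apply, Pi.pow_apply]; ring

theorem ae_energy_nonneg (h : IsTraceNormedTriple a b c) (u v : ℝ → ℂ) :
    ∀ᵐ t ∂volume.restrict (Ici (0 : ℝ)), 0 ≤ energy a b c u v t := by
  filter_upwards [h.bounds] with t ⟨ha, hc, hb, _⟩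
  exact form_nonneg ha hc hb

theorem integral_energy_nonneg (h : IsTraceNormedTriple a b c) (u v : ℝ → ℂ) {s t : ℝ}
    (hs : 0 ≤ s) (hst : s ≤ t) : 0 ≤ ∫ x in s..t, energy a b c u v x :=
  intervalIntegral.integral_nonneg_of_ae_restrict hst (ae_Icc_of_ae_Ici (ae_energy_nonneg h u v) hs)

theorem IsTraceNormedTriple.swap (h : IsTraceNormedTriple a b c) :
    IsTraceNormedTriple c (fun t => -b t) a where
  fst := h.snd
  mid := h.mid.neg
  snd := h.fst
  bounds := by
    filter_upwards [h.bounds] with t ⟨ha, hc, hb, htr⟩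
    exact ⟨hc, ha, by rw [neg_sq, mul_comm]; exact hb, by rw [add_comm]; exact htr⟩

namespace IsTraceNormedTriple

theorem integral_fst_nonneg (h : IsTraceNormedTriple a b c) {s t : ℝ} (hs : 0 ≤ s) (hst : s ≤ t) :
    0 ≤ ∫ x in s..t, a x :=
  intervalIntegral.integral_nonneg_of_ae_restrict hst
    ((ae_Icc_of_ae_Ici h.bounds hs).mono fun _ h => h.1)

theorem integral_fst_le (h : IsTraceNormedTriple a b c) {s t : ℝ} (hs : 0 ≤ s) (hst : s ≤ t) :
    ∫ x in s..t, a x ≤ t - s := by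
  simpa using intervalIntegral.integral_mono_ae_restrict hst
    (intervalIntegrable_of_nonneg h.fst hs (hs.trans hst)) (intervalIntegrable_const (c := (1 : ℝ)))
    ((ae_Icc_of_ae_Ici h.bounds hs).mono fun x hx => by linarith [hx.2.1, hx.2.2.2])

theorem integral_snd_nonneg (h : IsTraceNormedTriple a b c) {s t : ℝ} (hs : 0 ≤ s) (hst : s ≤ t) :
    0 ≤ ∫ x in s..t, c x :=
  h.swap.integral_fst_nonneg hs hst

theorem integral_snd_le (h : IsTraceNormedTriple a b c) {s t : ℝ} (hs : 0 ≤ s) (hst : s ≤ t) :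
    ∫ x in s..t, c x ≤ t - s :=
  h.swap.integral_fst_le hs hst

theorem integral_fst_add_integral_snd (h : IsTraceNormedTriple a b c) {s t : ℝ} (hs : 0 ≤ s)
    (hst : s ≤ t) : (∫ x in s..t, a x) + ∫ x in s..t, c x = t - s := by
  rw [← intervalIntegral.integral_add (intervalIntegrable_of_nonneg h.fst hs (hs.trans hst))
    (intervalIntegrable_of_nonneg h.snd hs (hs.trans hst))]
  rw [intervalIntegral.integral_congr_ae_restrict (g := fun _ => (1 : ℝ)), integral_one]
  rw [uIoc_of_le hst]
  exact ae_restrict_of_ae_restrict_of_subset (fun _ hx => hs.trans hx.1.le)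
    (h.bounds.mono fun x hx => hx.2.2.2)

end IsTraceNormedTriple

/-! ### Increments, Green's identity and the limit point property -/

namespace IsSolution

theorem intervalIntegrable_fst (h : IsTraceNormedTriple a b c) (hs : IsSolution a b c z u v)
    {s t : ℝ} (hs0 : 0 ≤ s) (ht : 0 ≤ t) :
    IntervalIntegrable (fun t => (b t : ℂ) * u t + c t * v t) volume s t :=
  (intervalIntegrable_ofReal_mul h.mid hs.cont_fst hs0 ht).add
    (intervalIntegrable_ofReal_mul h.snd hs.cont_snd hs0 ht)

theorem intervalIntegrable_snd (h : IsTraceNormedTriple a b c) (hs : IsSolution a b c z u v)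
    {s t : ℝ} (hs0 : 0 ≤ s) (ht : 0 ≤ t) :
    IntervalIntegrable (fun t => (a t : ℂ) * u t + b t * v t) volume s t :=
  (intervalIntegrable_ofReal_mul h.fst hs.cont_fst hs0 ht).add
    (intervalIntegrable_ofReal_mul h.mid hs.cont_snd hs0 ht)

/-- Rotation of the plane by a right angle commutes with `J` and turns `H` into the matrix with
diagonal entries exchanged and `b` negated. This reduces the statement about `C` to the one about
`A`. -/
theorem swap (hs : IsSolution a b c z u v) :
    IsSolution c (fun t => -b t) a z v (fun t => -u t) where
  cont_fst := hs.cont_snd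
  cont_snd := hs.cont_fst.neg
  fst x hx := by
    rw [hs.snd x hx, neg_mul, ← mul_neg, ← intervalIntegral.integral_neg]
    congr 2; funext t; push_cast; ring
  snd x hx := by
    rw [neg_sub_neg, ← neg_sub, hs.fst x hx, neg_mul]
    congr 3; funext t; push_cast; ring

theorem fst_sub (h : IsTraceNormedTriple a b c) (hs : IsSolution a b c z u v) {s t : ℝ}
    (hs0 : 0 ≤ s) (ht : 0 ≤ t) :
    u t - u s = z * ∫ x in s..t, (b x * u x + c x * v x) := by
  rw [← intervalIntegral.integral_interval_sub_left (hs.intervalIntegrable_fst h le_rfl ht)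
    (hs.intervalIntegrable_fst h le_rfl hs0), mul_sub, ← hs.fst t ht, ← hs.fst s hs0]
  ring

theorem snd_sub (h : IsTraceNormedTriple a b c) (hs : IsSolution a b c z u v) {s t : ℝ}
    (hs0 : 0 ≤ s) (ht : 0 ≤ t) :
    v t - v s = -z * ∫ x in s..t, (a x * u x + b x * v x) := by
  rw [← intervalIntegral.integral_interval_sub_left (hs.intervalIntegrable_snd h le_rfl ht)
    (hs.intervalIntegrable_snd h le_rfl hs0), mul_sub, ← hs.snd t ht, ← hs.snd s hs0]
  ring

/-- Cauchy–Schwarz, with the integrand bounded by `c` times the energy density through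
`sq_norm_snd_le`. -/
theorem norm_fst_sub_sq_le (h : IsTraceNormedTriple a b c) (hs : IsSolution a b c z u v)
    {s t : ℝ} (hs0 : 0 ≤ s) (hst : s ≤ t) :
    ‖u t - u s‖ ^ 2 ≤ ‖z‖ ^ 2 * ((∫ x in s..t, c x) * ∫ x in s..t, energy a b c u v x) := by
  have ht := hs0.trans hst
  rw [hs.fst_sub h hs0 ht, norm_mul, mul_pow]
  refine mul_le_mul_of_nonneg_left (norm_integral_sq_le hst (hs.intervalIntegrable_fst h hs0 ht)
    (intervalIntegrable_of_nonneg h.snd hs0 ht)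
    (intervalIntegrable_energy h hs.cont_fst hs.cont_snd hs0 ht) ?_) (sq_nonneg _)
  filter_upwards [ae_Icc_of_ae_Ici h.bounds hs0] with x ⟨ha, hc, hb, _⟩
  exact ⟨hc, form_nonneg ha hc hb, sq_norm_snd_le hb⟩

theorem norm_snd_sub_sq_le (h : IsTraceNormedTriple a b c) (hs : IsSolution a b c z u v)
    {s t : ℝ} (hs0 : 0 ≤ s) (hst : s ≤ t) :
    ‖v t - v s‖ ^ 2 ≤ ‖z‖ ^ 2 * ((∫ x in s..t, a x) * ∫ x in s..t, energy a b c u v x) := by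
  have ht := hs0.trans hst
  rw [hs.snd_sub h hs0 ht, norm_mul, norm_neg, mul_pow]
  refine mul_le_mul_of_nonneg_left (norm_integral_sq_le hst (hs.intervalIntegrable_snd h hs0 ht)
    (intervalIntegrable_of_nonneg h.fst hs0 ht)
    (intervalIntegrable_energy h hs.cont_fst hs.cont_snd hs0 ht) ?_) (sq_nonneg _)
  filter_upwards [ae_Icc_of_ae_Ici h.bounds hs0] with x ⟨ha, hc, hb, _⟩
  exact ⟨ha, form_nonneg ha hc hb, sq_norm_fst_le hb⟩

/-- Green's identity for a solution and its complex conjugate. -/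
theorem wronskian_sub (h : IsTraceNormedTriple a b c) (hs : IsSolution a b c z u v) {X : ℝ}
    (hX : 0 ≤ X) :
    ((u X).im * (v X).re - (u X).re * (v X).im) - ((u 0).im * (v 0).re - (u 0).re * (v 0).im)
      = z.im * ∫ x in (0 : ℝ)..X, energy a b c u v x := by
  set φ : ℝ → ℂ := fun x => z * (b x * u x + c x * v x) with hφ
  set ψ : ℝ → ℂ := fun x => -z * (a x * u x + b x * v x) with hψ
  have iφ : ∀ x, 0 ≤ x → IntervalIntegrable φ volume 0 x := fun x hx =>
    (hs.intervalIntegrable_fst h le_rfl hx).const_mul z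
  have iψ : ∀ x, 0 ≤ x → IntervalIntegrable ψ volume 0 x := fun x hx =>
    (hs.intervalIntegrable_snd h le_rfl hx).const_mul (-z)
  have eu : ∀ x, 0 ≤ x → u x = u 0 + ∫ t in (0 : ℝ)..x, φ t := fun x hx => by
    rw [intervalIntegral.integral_const_mul, ← hs.fst x hx]; ring
  have ev : ∀ x, 0 ≤ x → v x = v 0 + ∫ t in (0 : ℝ)..x, ψ t := fun x hx => by
    rw [intervalIntegral.integral_const_mul, ← hs.snd x hx]; ring
  have ire : ∀ {w : ℝ → ℂ} {x : ℝ}, IntervalIntegrable w volume 0 x →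
      IntervalIntegrable (fun t => (w t).re) volume 0 x := fun hw => ⟨hw.1.re, hw.2.re⟩
  have iim : ∀ {w : ℝ → ℂ} {x : ℝ}, IntervalIntegrable w volume 0 x →
      IntervalIntegrable (fun t => (w t).im) volume 0 x := fun hw => ⟨hw.1.im, hw.2.im⟩
  have ere : ∀ {w g : ℝ → ℂ}, (∀ x, 0 ≤ x → IntervalIntegrable g volume 0 x) →
      (∀ x, 0 ≤ x → w x = w 0 + ∫ t in (0 : ℝ)..x, g t) →
      ∀ x ∈ Icc 0 X, (w x).re = (w 0).re + ∫ t in (0 : ℝ)..x, (g t).re := by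
    intro w g hg hw x hx
    rw [hw x hx.1, Complex.add_re]
    exact congrArg _ (Complex.reCLM.intervalIntegral_comp_comm (hg x hx.1)).symm
  have eim : ∀ {w g : ℝ → ℂ}, (∀ x, 0 ≤ x → IntervalIntegrable g volume 0 x) →
      (∀ x, 0 ≤ x → w x = w 0 + ∫ t in (0 : ℝ)..x, g t) →
      ∀ x ∈ Icc 0 X, (w x).im = (w 0).im + ∫ t in (0 : ℝ)..x, (g t).im := by
    intro w g hg hw x hx
    rw [hw x hx.1, Complex.add_im]
    exact congrArg _ (Complex.imCLM.intervalIntegral_comp_comm (hg x hx.1)).symm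
  have sub : uIcc 0 X ⊆ Ici (0 : ℝ) := fun x hx => (le_min le_rfl hX).trans hx.1
  have cu := hs.cont_fst.mono sub
  have cv := hs.cont_snd.mono sub
  have p1 := mul_sub_mul_eq_integral (f := fun x => (u x).im) (g := fun x => (v x).re) hX
    (iim (iφ X hX)) (ire (iψ X hX)) (eim iφ eu) (ere iψ ev)
  have p2 := mul_sub_mul_eq_integral (f := fun x => (u x).re) (g := fun x => (v x).im) hX
    (ire (iφ X hX)) (iim (iψ X hX)) (ere iφ eu) (eim iψ ev)
  have cre := fun {w : ℝ → ℂ} (hw : ContinuousOn w (uIcc 0 X)) =>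
    Complex.continuous_re.comp_continuousOn hw
  have cim := fun {w : ℝ → ℂ} (hw : ContinuousOn w (uIcc 0 X)) =>
    Complex.continuous_im.comp_continuousOn hw
  have j1 := ((iim (iφ X hX)).mul_continuousOn (cre cv)).add
    ((ire (iψ X hX)).continuousOn_mul (cim cu))
  have j2 := ((ire (iφ X hX)).mul_continuousOn (cim cv)).add
    ((iim (iψ X hX)).continuousOn_mul (cre cu))
  rw [← intervalIntegral.integral_const_mul]
  have e : ((u X).im * (v X).re - (u X).re * (v X).im)
      - ((u 0).im * (v 0).re - (u 0).re * (v 0).im)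
      = ((u X).im * (v X).re - (u 0).im * (v 0).re)
        - ((u X).re * (v X).im - (u 0).re * (v 0).im) := by ring
  rw [e, p1, p2]
  refine (intervalIntegral.integral_sub j1 j2).symm.trans ?_
  congr 1
  funext x
  simp only [hφ, hψ, energy, Complex.sq_norm, Complex.normSq_apply, Complex.add_re, Complex.add_im,
    Complex.mul_re, Complex.mul_im, Complex.ofReal_re, Complex.ofReal_im, Complex.neg_re,
    Complex.neg_im, Function.comp_apply]
  ring

/-- If a solution has finite energy, its energy is bounded by the value prescribed by its initial
data: this is where the limit point property at `∞` enters. -/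
theorem integral_energy_le (h : IsTraceNormedTriple a b c) (hs : IsSolution a b c z u v)
    (hz : z.im ≠ 0) (hq : IntegrableOn (energy a b c u v) (Ici 0)) {X : ℝ} (hX : 0 ≤ X) :
    ∫ x in (0 : ℝ)..X, energy a b c u v x
      ≤ ((u 0).re * (v 0).im - (u 0).im * (v 0).re) / z.im := by
  set Q : ℝ := ∫ x in Ici (0 : ℝ), energy a b c u v x with hQ
  set W : ℝ := ((u 0).re * (v 0).im - (u 0).im * (v 0).re) / z.im with hW
  have hqnn := ae_energy_nonneg h u v
  have hQ0 : 0 ≤ Q := setIntegral_nonneg_of_ae_restrict hqnn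
  have hle : ∀ {x : ℝ}, 0 ≤ x → ∫ t in (0 : ℝ)..x, energy a b c u v t ≤ Q := by
    intro x hx
    rw [intervalIntegral.integral_of_le hx]
    exact setIntegral_mono_set hq hqnn (Filter.Eventually.of_forall fun x hx => hx.1.le)
  -- If the bound fails at `X` by `D`, then from `X` on the Wronskian has modulus at least `|Im z|
  -- D`. Since `‖u‖² + ‖v‖²` grows at most linearly, `sq_wronskian_le` forces the energy density to
  -- be at least a constant over `x`, contradicting integrability.
  by_contra! hlt
  set D : ℝ := (∫ x in (0 : ℝ)..X, energy a b c u v x) - W with hD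
  have hD0 : 0 < D := sub_pos.2 hlt
  have hWr : ∀ x, X ≤ x → z.im ^ 2 * D ^ 2 ≤ ((u x).im * (v x).re - (u x).re * (v x).im) ^ 2 := by
    intro x hx
    have h1 := hs.wronskian_sub h (hX.trans hx)
    have h2 := integral_energy_nonneg h u v hX hx
    have h3 := intervalIntegral.integral_add_adjacent_intervals
      (intervalIntegrable_energy h hs.cont_fst hs.cont_snd le_rfl hX)
      (intervalIntegrable_energy h hs.cont_fst hs.cont_snd hX (hX.trans hx))
    have h4 : (u x).im * (v x).re - (u x).re * (v x).im
        = z.im * ((∫ x in (0 : ℝ)..x, energy a b c u v x) - W) := by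
      rw [mul_sub, ← h1, hW, mul_div_cancel₀ _ hz]; ring
    rw [h4, mul_pow]
    refine mul_le_mul_of_nonneg_left (pow_le_pow_left₀ hD0.le ?_ 2) (sq_nonneg _)
    linarith
  set K : ℝ := 2 * (‖u 0‖ ^ 2 + ‖v 0‖ ^ 2) + 4 * ‖z‖ ^ 2 * Q + 1 with hK
  have hK0 : 0 < K := by positivity
  have growth : ∀ x, 1 ≤ x → ‖u x‖ ^ 2 + ‖v x‖ ^ 2 ≤ K * x := by
    intro x hx
    have hx0 : 0 ≤ x := zero_le_one.trans hx
    have g : ∀ {w : ℝ → ℂ} {p : ℝ}, p ≤ x →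
        ‖w x - w 0‖ ^ 2 ≤ ‖z‖ ^ 2 * (p * ∫ t in (0 : ℝ)..x, energy a b c u v t) →
        ‖w x‖ ^ 2 ≤ 2 * ‖w 0‖ ^ 2 + 2 * (‖z‖ ^ 2 * (x * Q)) := by
      intro w p hp hw
      have h1 : ‖w x - w 0‖ ^ 2 ≤ ‖z‖ ^ 2 * (x * Q) :=
        hw.trans (mul_le_mul_of_nonneg_left (mul_le_mul hp (hle hx0)
          (integral_energy_nonneg h u v le_rfl hx0) hx0) (sq_nonneg _))
      have h2 : ‖w x‖ ≤ ‖w x - w 0‖ + ‖w 0‖ := by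
        simpa using norm_add_le (w x - w 0) (w 0)
      nlinarith [sq_nonneg (‖w x - w 0‖ - ‖w 0‖), pow_le_pow_left₀ (norm_nonneg _) h2 2]
    have g1 := g (h.integral_snd_le le_rfl hx0 |>.trans (sub_zero x).le)
      (hs.norm_fst_sub_sq_le h le_rfl hx0)
    have g2 := g (h.integral_fst_le le_rfl hx0 |>.trans (sub_zero x).le)
      (hs.norm_snd_sub_sq_le h le_rfl hx0)
    nlinarith [sq_nonneg ‖u 0‖, sq_nonneg ‖v 0‖]
  have hd : 0 < z.im ^ 2 * D ^ 2 := by positivity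
  -- Beyond `max X 1` both the Wronskian bound (from `X`) and the linear growth bound (from `1`) are
  -- available.
  refine not_integrableOn_Ioi_inv (a := max X 1) ?_
  have hsub : Ioi (max X 1) ⊆ Ici (0 : ℝ) := fun x hx => hX.trans ((le_max_left _ _).trans hx.le)
  refine ((hq.mono_set hsub).const_mul (K / (z.im ^ 2 * D ^ 2))).mono'
    measurable_inv.aestronglyMeasurable ?_
  filter_upwards [ae_restrict_of_ae_restrict_of_subset hsub h.bounds,
    ae_restrict_mem measurableSet_Ioi] with x ⟨ha, hc, hb, htr⟩ hx
  have hxX : X ≤ x := (le_max_left _ _).trans hx.le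
  have hx1 : 1 ≤ x := (le_max_right _ _).trans hx.le
  have hx0 : 0 < x := zero_lt_one.trans_le hx1
  have h1 := (hWr x hxX).trans (sq_wronskian_le ha hc hb htr)
  have h2 := h1.trans (mul_le_mul_of_nonneg_left (growth x hx1) (form_nonneg ha hc hb))
  rw [Real.norm_of_nonneg (inv_nonneg.2 hx0.le), inv_le_iff_one_le_mul₀ hx0, div_mul_eq_mul_div,
    div_mul_eq_mul_div, one_le_div hd]
  calc _ ≤ _ := h2
    _ = _ := by rw [energy]; ring

end IsSolution

end

/-! ### Estimates at the scale `x₀`, normalised by `r² x₀ A₀ = 1` -/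

namespace IsSolution

variable {a b c : ℝ → ℝ} {z : ℂ} {u v : ℝ → ℂ}

section Scaled

variable {r R L x₀ A₀ : ℝ}

theorem integral_energy_le_of_le (h : IsTraceNormedTriple a b c) (hs : IsSolution a b c z u v)
    {E : ℝ} (hE : ∀ X, 0 ≤ X → ∫ x in (0 : ℝ)..X, energy a b c u v x ≤ E) {s t : ℝ} (hs0 : 0 ≤ s)
    (hst : s ≤ t) : ∫ x in s..t, energy a b c u v x ≤ E := by
  have h1 := intervalIntegral.integral_add_adjacent_intervals
    (intervalIntegrable_energy h hs.cont_fst hs.cont_snd le_rfl hs0)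
    (intervalIntegrable_energy h hs.cont_fst hs.cont_snd hs0 (hs0.trans hst))
  linarith [integral_energy_nonneg h u v le_rfl hs0, hE t (hs0.trans hst)]

/-- The natural units are `x₀` for length and `A₀` for energy: the normalisation cancels all scales
and leaves a bound in `R`, `L` and the relative length `τ²`. -/
theorem norm_fst_sub_le (h : IsTraceNormedTriple a b c) (hs : IsSolution a b c z u v)
    (hR : 0 ≤ R) (hL : 0 ≤ L) (hz : ‖z‖ ≤ r * R) (hx : r ^ 2 * x₀ * A₀ = 1)
    (hE : ∀ X, 0 ≤ X → ∫ x in (0 : ℝ)..X, energy a b c u v x ≤ L ^ 2 * A₀) {s t τ : ℝ}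
    (hs0 : 0 ≤ s) (hst : s ≤ t) (hτ : 0 ≤ τ) (ht : t - s ≤ τ ^ 2 * x₀) :
    ‖u t - u s‖ ≤ R * L * τ := by
  refine abs_le_of_sq_le_sq' ?_ (by positivity) |>.2
  have h0 : 0 ≤ t - s := sub_nonneg.2 hst
  calc ‖u t - u s‖ ^ 2 ≤ ‖z‖ ^ 2 * ((∫ x in s..t, c x) * ∫ x in s..t, energy a b c u v x) :=
        hs.norm_fst_sub_sq_le h hs0 hst
    _ ≤ (r * R) ^ 2 * ((τ ^ 2 * x₀) * (L ^ 2 * A₀)) := by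
        refine mul_le_mul (pow_le_pow_left₀ (norm_nonneg _) hz 2) (mul_le_mul
          ((h.integral_snd_le hs0 hst).trans ht) (hs.integral_energy_le_of_le h hE hs0 hst)
          (integral_energy_nonneg h u v hs0 hst) (h0.trans ht))
          (mul_nonneg (h.integral_snd_nonneg hs0 hst) (integral_energy_nonneg h u v hs0 hst))
          (sq_nonneg _)
    _ = (r ^ 2 * x₀ * A₀) * (R * L * τ) ^ 2 := by ring
    _ = (R * L * τ) ^ 2 := by rw [hx, one_mul]

theorem norm_snd_sub_le (h : IsTraceNormedTriple a b c) (hs : IsSolution a b c z u v)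
    (hr : 0 < r) (hR : 0 ≤ R) (hL : 0 ≤ L) (hz : ‖z‖ ≤ r * R) (hx : r ^ 2 * x₀ * A₀ = 1)
    (hx₀ : 0 < x₀)
    (hE : ∀ X, 0 ≤ X → ∫ x in (0 : ℝ)..X, energy a b c u v x ≤ L ^ 2 * A₀) {t α : ℝ}
    (ht : 0 ≤ t) (hα : 0 ≤ α) (hA : ∫ x in (0 : ℝ)..t, a x ≤ α ^ 2 * A₀) :
    r * x₀ * ‖v t - v 0‖ ≤ R * L * α := by
  refine abs_le_of_sq_le_sq' ?_ (by positivity) |>.2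
  have h0 := h.integral_fst_nonneg le_rfl ht
  have h1 : ‖v t - v 0‖ ^ 2 ≤ (r * R) ^ 2 * ((α ^ 2 * A₀) * (L ^ 2 * A₀)) :=
    (hs.norm_snd_sub_sq_le h le_rfl ht).trans <|
      mul_le_mul (pow_le_pow_left₀ (norm_nonneg _) hz 2) (mul_le_mul hA (hE t ht)
        (integral_energy_nonneg h u v le_rfl ht) (h0.trans hA))
        (mul_nonneg h0 (integral_energy_nonneg h u v le_rfl ht)) (sq_nonneg _)
  calc (r * x₀ * ‖v t - v 0‖) ^ 2 = (r * x₀) ^ 2 * ‖v t - v 0‖ ^ 2 := by ring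
    _ ≤ (r * x₀) ^ 2 * ((r * R) ^ 2 * ((α ^ 2 * A₀) * (L ^ 2 * A₀))) := by gcongr
    _ = (r ^ 2 * x₀ * A₀) ^ 2 * (R * L * α) ^ 2 := by ring
    _ = (R * L * α) ^ 2 := by rw [hx]; ring

variable {M w x₁ : ℝ}

/-- The first component becomes small once a large amount of the mass of `a` has been passed. -/
theorem exists_norm_fst_le (h : IsTraceNormedTriple a b c) (hs : IsSolution a b c z u v)
    (hr : 0 < r) (hR : 0 ≤ R) (hL : 0 ≤ L) (hM : 0 < M) (hz : ‖z‖ ≤ r * R)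
    (hx : r ^ 2 * x₀ * A₀ = 1) (hx₀ : 0 < x₀)
    (hE : ∀ X, 0 ≤ X → ∫ x in (0 : ℝ)..X, energy a b c u v x ≤ L ^ 2 * A₀)
    (hv : r * x₀ * ‖v 0‖ ≤ M) (hA₀ : ∫ x in (0 : ℝ)..x₀, a x = A₀) (hw : 0 < w) (hw' : w ≤ 1 / 2)
    (hx₁ : x₀ ≤ x₁) (hx₁' : x₁ ≤ x₀ + w ^ 4 * x₀)
    (hA₁ : w ^ 2 * ∫ x in (0 : ℝ)..x₁, a x = A₀) :
    ∃ ξ ∈ Icc x₀ x₁, ‖u ξ‖ ≤ 2 * w * (L + (M + R * L)) := by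
  by_contra! hcon
  set N := M + R * L with hN
  have hN0 : 0 < N := by positivity
  have hx₁0 : 0 ≤ x₁ := hx₀.le.trans hx₁
  have hrx : 0 < r * x₀ := mul_pos hr hx₀
  have hA₀0 : 0 < A₀ := by
    have : 0 < (r ^ 2 * x₀) * A₀ := by rw [hx]; exact one_pos
    exact pos_of_mul_pos_right this (by positivity)
  set n := 2 * w * (L + N) with hn
  have hn0 : 0 < n := by positivity
  have isplit := intervalIntegral.integral_add_adjacent_intervals
    (intervalIntegrable_of_nonneg h.fst le_rfl hx₀.le)
    (intervalIntegrable_of_nonneg h.fst hx₀.le hx₁0)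
  -- On `[x₀, x₁]` the mass of `a` reaches `A₀ / w²`, so `v` may grow by a factor of order `1 / w`,
  -- but no more.
  have hvx : ∀ x ∈ Icc x₀ x₁, w * (r * x₀ * ‖v x‖) ≤ N := by
    intro x hx'
    have hx0 := hx₀.le.trans hx'.1
    have hAx : ∫ t in (0 : ℝ)..x, a t ≤ (1 / w) ^ 2 * A₀ := by
      have h1 := intervalIntegral.integral_add_adjacent_intervals
        (intervalIntegrable_of_nonneg h.fst le_rfl hx0)
        (intervalIntegrable_of_nonneg h.fst hx0 hx₁0)
      have h2 := h.integral_fst_nonneg hx0 hx'.2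
      rw [← hA₁]; field_simp; linarith
    have h3 := hs.norm_snd_sub_le h hr hR hL hz hx hx₀ hE hx0 (by positivity) hAx
    have h4 : ‖v x‖ ≤ ‖v x - v 0‖ + ‖v 0‖ := by simpa using norm_add_le (v x - v 0) (v 0)
    have h5 : r * x₀ * ‖v x‖ ≤ R * L * (1 / w) + M := by
      linarith [mul_le_mul_of_nonneg_left h4 hrx.le]
    calc w * (r * x₀ * ‖v x‖) ≤ w * (R * L * (1 / w) + M) := by gcongr
      _ = R * L + w * M := by field_simp
      _ ≤ N := by rw [hN]; linarith [mul_le_mul_of_nonneg_right hw' hM.le]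
  -- The growth `1 / w` of `v` is harmless because the interval has length at most `w⁴ x₀`: its
  -- contribution `V² w⁴ x₀` equals `w² A₀ N²`.
  have hlow : n ^ 2 * ∫ x in x₀..x₁, a x ≤ 2 * (L ^ 2 * A₀) + 2 * (w ^ 2 * A₀ * N ^ 2) := by
    set V := N / (w * (r * x₀)) with hV
    have i1 := intervalIntegrable_of_nonneg h.fst hx₀.le hx₁0
    have i2 := intervalIntegrable_of_nonneg h.snd hx₀.le hx₁0
    have i3 := intervalIntegrable_energy h hs.cont_fst hs.cont_snd hx₀.le hx₁0
    have hmono : ∫ x in x₀..x₁, n ^ 2 * a x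
        ≤ ∫ x in x₀..x₁, (2 * energy a b c u v x + 2 * V ^ 2 * c x) := by
      refine intervalIntegral.integral_mono_ae_restrict hx₁ (i1.const_mul _)
        ((i3.const_mul _).add (i2.const_mul _)) ?_
      filter_upwards [ae_Icc_of_ae_Ici h.bounds hx₀.le, ae_restrict_mem measurableSet_Icc]
        with x ⟨ha, hc, hb, _⟩ hxI
      have h1 := fst_mul_sq_le (u := u x) (v := v x) ha hc hb
      have h2 : ‖v x‖ ≤ V := by
        rw [hV, le_div_iff₀ (by positivity)]; linarith [hvx x hxI]
      have h3 : ‖v x‖ ^ 2 ≤ V ^ 2 := pow_le_pow_left₀ (norm_nonneg _) h2 2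
      have h4 : n ^ 2 ≤ ‖u x‖ ^ 2 := pow_le_pow_left₀ hn0.le (hcon x hxI).le 2
      have h5 := mul_le_mul_of_nonneg_left h3 hc
      have h6 := mul_le_mul_of_nonneg_left h4 ha
      simp only [energy]
      linarith
    rw [intervalIntegral.integral_const_mul, intervalIntegral.integral_add (i3.const_mul _)
      (i2.const_mul _), intervalIntegral.integral_const_mul, intervalIntegral.integral_const_mul]
      at hmono
    have h1 := hs.integral_energy_le_of_le h hE hx₀.le hx₁
    have h2 : ∫ x in x₀..x₁, c x ≤ w ^ 4 * x₀ := by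
      linarith [h.integral_snd_le hx₀.le hx₁]
    have h3 : V ^ 2 * (w ^ 4 * x₀) = w ^ 2 * A₀ * N ^ 2 := by
      have : A₀ = 1 / (r ^ 2 * x₀) := by field_simp; linarith
      rw [hV, this]; field_simp
    linarith [mul_le_mul_of_nonneg_left h2 (sq_nonneg V)]
  have hmass : ∫ x in x₀..x₁, a x = A₀ / w ^ 2 - A₀ := by
    rw [hA₀] at isplit
    have : ∫ x in (0 : ℝ)..x₁, a x = A₀ / w ^ 2 := by rw [← hA₁]; field_simp
    linarith
  have h1 : n ^ 2 * (A₀ / w ^ 2 - A₀) = 4 * (L + N) ^ 2 * (1 - w ^ 2) * A₀ := by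
    rw [hn]; field_simp; ring
  rw [hmass, h1] at hlow
  -- As `w² ≤ 1/4`, this would give `3 (L + N)² ≤ 2 L² + N² / 2`, impossible for `N > 0`.
  have h2 : 4 * (L + N) ^ 2 * (1 - w ^ 2) ≤ 2 * L ^ 2 + 2 * w ^ 2 * N ^ 2 :=
    le_of_mul_le_mul_right (by linarith) hA₀0
  have h3 : w ^ 2 ≤ 1 / 4 := by nlinarith
  linarith [mul_le_mul_of_nonneg_left h3 (sq_nonneg (L + N)),
    mul_le_mul_of_nonneg_left h3 (sq_nonneg N), mul_nonneg hL hN0.le, sq_nonneg L, pow_pos hN0 2]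

/-- Up to the scale `x₀` the solution behaves as for the constant Hamiltonian `diag(0, 1)`. -/
theorem norm_fst_sub_linear_le (h : IsTraceNormedTriple a b c) (hs : IsSolution a b c z u v)
    (hr : 0 < r) (hR : 0 ≤ R) (hL : 0 ≤ L) (hz : ‖z‖ ≤ r * R)
    (hx : r ^ 2 * x₀ * A₀ = 1) (hx₀ : 0 < x₀)
    (hE : ∀ X, 0 ≤ X → ∫ x in (0 : ℝ)..X, energy a b c u v x ≤ L ^ 2 * A₀)
    (hu : ‖u 0‖ ≤ M) (hv : r * x₀ * ‖v 0‖ ≤ M) (hA₀ : ∫ x in (0 : ℝ)..x₀, a x = A₀)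
    (hw : 0 < w) (hw' : w ≤ 1 / 2) {x : ℝ} (hx1 : x = x₀ - w ^ 4 * x₀)
    (hAx : ∫ t in (0 : ℝ)..x, a t ≤ w ^ 2 * A₀) :
    ‖u 0 + z * x₀ * v 0 - u x‖ ≤ w * (R * (M + R * L) + R ^ 2 * L + 2 * R * M) := by
  have hw4 : w ^ 4 ≤ w := by
    simpa using pow_le_pow_of_le_one hw.le (by linarith) (show 1 ≤ 4 by norm_num)
  have hw2 : w ^ 2 ≤ w := by
    simpa using pow_le_pow_of_le_one hw.le (by linarith) (show 1 ≤ 2 by norm_num)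
  have hx0 : 0 ≤ x := by rw [hx1]; nlinarith
  have hxx₀ : x ≤ x₀ := by rw [hx1]; nlinarith [pow_pos hw 4]
  have hA₀x : A₀ ≤ x₀ := by simpa [hA₀] using h.integral_fst_le le_rfl hx₀.le
  have hrx : 0 < r * x₀ := mul_pos hr hx₀
  have hM : 0 ≤ M := (norm_nonneg _).trans hu
  set N := M + R * L with hN
  have hN0 : 0 ≤ N := by positivity
  have ib := intervalIntegrable_ofReal_mul h.mid hs.cont_fst le_rfl hx0
  have icv : IntervalIntegrable (fun t => (c t : ℂ) * (v t - v 0)) volume 0 x :=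
    intervalIntegrable_ofReal_mul h.snd (hs.cont_snd.sub continuousOn_const) le_rfl hx0
  have ic0 := intervalIntegrable_ofReal_mul h.snd (continuousOn_const (c := v 0)) le_rfl hx0
  have ia := intervalIntegrable_of_nonneg h.fst le_rfl hx0
  -- The last term is the main one, with `∫ c` close to `x₀`. The first is small because `b² ≤ ac ≤
  -- a`, the second because `v` hardly moves while the mass of `a` is at most `w² A₀`.
  have split : u x - u 0 = z * (∫ t in (0 : ℝ)..x, (b t : ℂ) * u t)
      + z * (∫ t in (0 : ℝ)..x, (c t : ℂ) * (v t - v 0))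
      + z * v 0 * ((∫ t in (0 : ℝ)..x, c t : ℝ) : ℂ) := by
    have e : ∫ t in (0 : ℝ)..x, (c t : ℂ) * v 0 = v 0 * ((∫ t in (0 : ℝ)..x, c t : ℝ) : ℂ) := by
      rw [intervalIntegral.integral_mul_const, intervalIntegral.integral_ofReal, mul_comm]
    rw [hs.fst x hx0, mul_assoc z (v 0), ← e, ← mul_add, ← mul_add,
      ← intervalIntegral.integral_add ib icv, ← intervalIntegral.integral_add (ib.add icv) ic0]
    congr 2; funext t; ring
  have hub : ∀ t ∈ Icc 0 x, ‖u t‖ ≤ N := by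
    intro t ht
    have h1 := hs.norm_fst_sub_le h hR hL hz hx hE (τ := 1) le_rfl ht.1 zero_le_one
      (by linarith [ht.2])
    have h2 : ‖u t‖ ≤ ‖u t - u 0‖ + ‖u 0‖ := by simpa using norm_add_le (u t - u 0) (u 0)
    rw [hN]; linarith
  have e1 : ‖z * ∫ t in (0 : ℝ)..x, (b t : ℂ) * u t‖ ≤ w * (R * N) := by
    have h1 := norm_integral_sq_le (q := fun _ => N ^ 2) hx0 ib ia intervalIntegrable_const (by
      filter_upwards [ae_Icc_of_ae_Ici h.bounds le_rfl, ae_restrict_mem measurableSet_Icc]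
        with t ⟨ha, hc, hb, htr⟩ ht
      refine ⟨ha, sq_nonneg _, ?_⟩
      rw [norm_mul, mul_pow, Complex.norm_real, Real.norm_eq_abs, sq_abs]
      exact mul_le_mul (hb.trans (by nlinarith)) (pow_le_pow_left₀ (norm_nonneg _) (hub t ht) 2)
        (sq_nonneg _) ha)
    rw [intervalIntegral.integral_const, smul_eq_mul, sub_zero] at h1
    refine abs_le_of_sq_le_sq' ?_ (by positivity) |>.2
    rw [norm_mul, mul_pow]
    calc ‖z‖ ^ 2 * ‖∫ t in (0 : ℝ)..x, (b t : ℂ) * u t‖ ^ 2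
        ≤ (r * R) ^ 2 * ((w ^ 2 * A₀) * (x₀ * N ^ 2)) := by
          refine mul_le_mul (pow_le_pow_left₀ (norm_nonneg _) hz 2) (h1.trans ?_) (sq_nonneg _)
            (sq_nonneg _)
          exact mul_le_mul hAx (by gcongr) (by positivity)
            ((h.integral_fst_nonneg le_rfl hx0).trans hAx)
      _ = (r ^ 2 * x₀ * A₀) * (w * (R * N)) ^ 2 := by ring
      _ = (w * (R * N)) ^ 2 := by rw [hx, one_mul]
  have e2 : ‖z * ∫ t in (0 : ℝ)..x, (c t : ℂ) * (v t - v 0)‖ ≤ w * (R ^ 2 * L) := by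
    have hbd : ∀ᵐ t : ℝ, t ∈ uIoc 0 x → ‖(c t : ℂ) * (v t - v 0)‖ ≤ R * L * w / (r * x₀) := by
      rw [uIoc_of_le hx0, ← ae_restrict_iff' measurableSet_Ioc]
      have hsub : Ioc 0 x ⊆ Ici (0 : ℝ) := fun t ht => ht.1.le
      filter_upwards [ae_restrict_of_ae_restrict_of_subset hsub h.bounds,
        ae_restrict_mem measurableSet_Ioc] with t ⟨ha, hc, hb, htr⟩ ht
      have h1 := intervalIntegral.integral_add_adjacent_intervals
        (intervalIntegrable_of_nonneg h.fst le_rfl ht.1.le)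
        (intervalIntegrable_of_nonneg h.fst ht.1.le hx0)
      have h2 := h.integral_fst_nonneg ht.1.le ht.2
      have h3 := hs.norm_snd_sub_le h hr hR hL hz hx hx₀ hE ht.1.le hw.le (by linarith)
      rw [le_div_iff₀ hrx, norm_mul, Complex.norm_real, Real.norm_of_nonneg hc]
      nlinarith [mul_nonneg hrx.le (norm_nonneg (v t - v 0))]
    have h1 := intervalIntegral.norm_integral_le_of_norm_le_const_ae hbd
    rw [sub_zero, abs_of_nonneg hx0] at h1
    rw [norm_mul]
    calc ‖z‖ * ‖∫ t in (0 : ℝ)..x, (c t : ℂ) * (v t - v 0)‖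
        ≤ (r * R) * (R * L * w / (r * x₀) * x₀) := by
          refine mul_le_mul hz (h1.trans ?_) (norm_nonneg _) (by positivity)
          gcongr
      _ = w * (R ^ 2 * L) := by field_simp
  have e3 : ‖z * v 0 * ((x₀ - ∫ t in (0 : ℝ)..x, c t : ℝ) : ℂ)‖ ≤ w * (2 * R * M) := by
    have h1 := h.integral_fst_add_integral_snd le_rfl hx0
    have h2 := h.integral_snd_le le_rfl hx0
    -- Trace one turns the left side into `w⁴ x₀ + A(x)`, and `A(x) ≤ w² A₀ ≤ w² x₀`.
    have h3 : x₀ - ∫ t in (0 : ℝ)..x, c t ≤ 2 * w * x₀ := by nlinarith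
    rw [norm_mul, norm_mul, Complex.norm_real, Real.norm_of_nonneg (by linarith)]
    calc ‖z‖ * ‖v 0‖ * (x₀ - ∫ t in (0 : ℝ)..x, c t) ≤ (r * R) * ‖v 0‖ * (2 * w * x₀) := by
          refine mul_le_mul (mul_le_mul_of_nonneg_right hz (norm_nonneg _)) h3 (by linarith)
            (by positivity)
      _ = 2 * R * w * (r * x₀ * ‖v 0‖) := by ring
      _ ≤ 2 * R * w * M := by gcongr
      _ = w * (2 * R * M) := by ring
  have e : u 0 + z * x₀ * v 0 - u x
      = z * v 0 * ((x₀ - ∫ t in (0 : ℝ)..x, c t : ℝ) : ℂ)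
        - z * (∫ t in (0 : ℝ)..x, (b t : ℂ) * u t)
        - z * (∫ t in (0 : ℝ)..x, (c t : ℂ) * (v t - v 0)) := by
    rw [Complex.ofReal_sub]
    linear_combination -split
  rw [e]
  refine (norm_sub_le _ _).trans ?_
  have := norm_sub_le (z * v 0 * ((x₀ - ∫ t in (0 : ℝ)..x, c t : ℝ) : ℂ))
    (z * ∫ t in (0 : ℝ)..x, (b t : ℂ) * u t)
  linarith

end Scaled

end IsSolution


/-! ### Initial values of finite-energy solutions -/

section

variable {a b c : ℝ → ℝ}

/-- The constant in the estimate of the initial values of a solution of finite energy. -/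
def boundConst (R k : ℝ) : ℝ :=
  2 * (1 / k + (1 + R / k)) + 2 * (R / k) + (R * (1 + R / k) + R ^ 2 / k + 2 * R)

theorem boundConst_pos {R k : ℝ} (hR : 0 ≤ R) (hk : 0 < k) : 0 < boundConst R k := by
  unfold boundConst; positivity

/-- Follows `u` from `0` to `x₀ - w⁴ x₀`, and from there to a point `ξ` at the wall where `u` is
small. The estimate is homogeneous in the initial data, so everything is measured in units of `M =
‖u 0‖ + r x₀ ‖v 0‖`, with `L = M / k`; the lower bound on `|Im μ|` is a square to avoid roots in
`L`. -/
theorem IsSolution.norm_initial_le {u v : ℝ → ℂ} {r R k x₀ A₀ w x₁ : ℝ} {μ : ℂ}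
    (h : IsTraceNormedTriple a b c) (hs : IsSolution a b c (r * μ) u v)
    (hq : IntegrableOn (energy a b c u v) (Ici 0)) (hr : 0 < r) (hμ : ‖μ‖ ≤ R) (hk : 0 < k)
    (hμk : k ^ 2 ≤ |μ.im|) (hx : r ^ 2 * x₀ * A₀ = 1) (hx₀ : 0 < x₀)
    (hA₀ : ∫ x in (0 : ℝ)..x₀, a x = A₀) (hw : 0 < w) (hw' : w ≤ 1 / 2)
    (hAx : ∫ t in (0 : ℝ)..(x₀ - w ^ 4 * x₀), a t ≤ w ^ 2 * A₀)
    (hx₁ : x₀ ≤ x₁) (hx₁' : x₁ ≤ x₀ + w ^ 4 * x₀)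
    (hA₁ : w ^ 2 * ∫ x in (0 : ℝ)..x₁, a x = A₀) :
    ‖u 0 + μ * (r * x₀ : ℝ) * v 0‖ ≤ w * boundConst R k * (‖u 0‖ + r * x₀ * ‖v 0‖) := by
  have hR : 0 ≤ R := (norm_nonneg _).trans hμ
  have hrx : 0 < r * x₀ := mul_pos hr hx₀
  set M := ‖u 0‖ + r * x₀ * ‖v 0‖ with hM
  have hv0 : 0 ≤ r * x₀ * ‖v 0‖ := by positivity
  rcases (add_nonneg (norm_nonneg (u 0)) hv0 : 0 ≤ M).eq_or_lt with hM0 | hM0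
  · have h1 : ‖u 0‖ = 0 := by linarith [norm_nonneg (u 0)]
    have h2 : ‖v 0‖ = 0 := by
      have : r * x₀ * ‖v 0‖ = 0 := by linarith [norm_nonneg (u 0)]
      exact (mul_eq_zero.1 this).resolve_left hrx.ne'
    rw [norm_eq_zero] at h1 h2
    rw [h1, h2, show M = 0 from hM0.symm]; simp
  have hz : ‖(r : ℂ) * μ‖ ≤ r * R := by
    rw [norm_mul, Complex.norm_real, Real.norm_of_nonneg hr.le]; gcongr
  have him : ((r : ℂ) * μ).im = r * μ.im := by simp
  have hμ0 : 0 < |μ.im| := (pow_pos hk 2).trans_le hμk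
  have hE : ∀ X, 0 ≤ X → ∫ x in (0 : ℝ)..X, energy a b c u v x ≤ (M / k) ^ 2 * A₀ := by
    intro X hX
    refine (hs.integral_energy_le h (by rw [him]; exact mul_ne_zero hr.ne' (abs_pos.1 hμ0)) hq
      hX).trans ((le_abs_self _).trans ?_)
    have h1 : |(u 0).re * (v 0).im - (u 0).im * (v 0).re| ≤ ‖u 0‖ * ‖v 0‖ := by
      have := Complex.abs_im_le_norm (starRingEnd ℂ (u 0) * v 0)
      rw [norm_mul, Complex.norm_conj] at this
      convert this using 2
      simp; ring
    have h2 : ‖u 0‖ * (r * x₀ * ‖v 0‖) ≤ M ^ 2 := by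
      rw [sq]; exact mul_le_mul (by linarith) (by linarith [norm_nonneg (u 0)]) hv0 hM0.le
    have h3 : A₀ = 1 / (r ^ 2 * x₀) := by field_simp; linarith
    rw [abs_div, him, abs_mul, abs_of_pos hr]
    calc _ ≤ ‖u 0‖ * ‖v 0‖ / (r * k ^ 2) := by gcongr
      _ = ‖u 0‖ * (r * x₀ * ‖v 0‖) / (r ^ 2 * x₀ * k ^ 2) := by field_simp
      _ ≤ M ^ 2 / (r ^ 2 * x₀ * k ^ 2) := by gcongr
      _ = (M / k) ^ 2 * A₀ := by rw [h3]; field_simp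
  have hL : 0 ≤ M / k := by positivity
  have hw4 : 0 < w ^ 4 := pow_pos hw 4
  have hw41 : w ^ 4 ≤ 1 := pow_le_one₀ hw.le (by linarith)
  have hx0 : 0 ≤ x₀ - w ^ 4 * x₀ := by nlinarith
  obtain ⟨ξ, hξ, hξu⟩ := hs.exists_norm_fst_le h hr hR hL hM0 hz hx hx₀ hE
    (by linarith [norm_nonneg (u 0)]) hA₀ hw hw' hx₁ hx₁' hA₁
  have e1 := hs.norm_fst_sub_linear_le h hr hR hL hz hx hx₀ hE (M := M) (by linarith)
    (by linarith [norm_nonneg (u 0)]) hA₀ hw hw' rfl hAx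
  -- The distance is at most `2 w⁴ x₀ ≤ (2w)² x₀`, whence `τ = 2w`.
  have e2 := hs.norm_fst_sub_le h hR hL hz hx hE (t := ξ) (τ := 2 * w) hx0
    (by nlinarith [hξ.1]) (by positivity) (by
      have h1 : 2 * w ^ 4 ≤ (2 * w) ^ 2 := by
        have : w ^ 4 ≤ w ^ 2 := pow_le_pow_of_le_one hw.le (by linarith) (by norm_num)
        nlinarith
      nlinarith [hξ.2, mul_le_mul_of_nonneg_right h1 hx₀.le])
  have e3 : u 0 + μ * (r * x₀ : ℝ) * v 0
      = (u 0 + (r * μ) * x₀ * v 0 - u (x₀ - w ^ 4 * x₀)) + u ξ - (u ξ - u (x₀ - w ^ 4 * x₀)) := by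
    push_cast; ring
  have e4 : w * boundConst R k * M
      = w * (R * (M + R * (M / k)) + R ^ 2 * (M / k) + 2 * R * M)
        + 2 * w * (M / k + (M + R * (M / k))) + R * (M / k) * (2 * w) := by
    unfold boundConst; field_simp; ring
  rw [e3, e4]
  exact (norm_sub_le _ _).trans (add_le_add ((norm_add_le _ _).trans (add_le_add e1 hξu)) e2)

/-! ### Rapid variation and the scale function -/

namespace IsTraceNormedTriple

theorem continuousOn_primitive (h : IsTraceNormedTriple a b c) {X : ℝ} (hX : 0 ≤ X) :
    ContinuousOn (fun x => ∫ t in (0 : ℝ)..x, a t) (Icc 0 X) := by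
  have h1 := h.fst.integrableOn_compact_subset (t := uIcc 0 X)
    (fun _ hx => (le_min le_rfl hX).trans hx.1) isCompact_uIcc
  simpa [uIcc_of_le hX] using intervalIntegral.continuousOn_primitive_interval h1

variable {A : ℝ → ℝ}

/-- Intermediate value theorem for `x A(x)`. Existence of a preimage suffices: the estimates use
only the equation `r² x₀ A₀ = 1`. -/
theorem scaleInv_spec (hA : A = fun x => ∫ t in (0 : ℝ)..x, a t)
    (h : IsTraceNormedTriple a b c) (hrv : IsRapidlyVaryingAtZero A) {y : ℝ}
    (hy : 0 < y) : 0 < scaleInv A y ∧ 1 / (scaleInv A y * A (scaleInv A y)) = y := by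
  have hex : ∃ x ∈ Ioi (0 : ℝ), 1 / (x * A x) = y := by
    set X := max 1 (1 / (y * A 1)) with hX
    have hA1 := hrv.2.1 1 one_pos
    have hX1 : 1 ≤ X := le_max_left _ _
    have hcont : ContinuousOn (fun x => x * A x) (Icc 0 X) := by
      rw [hA]; exact continuousOn_id.mul (h.continuousOn_primitive (zero_le_one.trans hX1))
    have hmem : 1 / y ∈ Icc (0 * A 0) (X * A X) := by
      refine ⟨by simp [hy.le], ?_⟩
      calc 1 / y = 1 / (y * A 1) * A 1 := by field_simp
        _ ≤ X * A X := mul_le_mul (le_max_right _ _)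
          (hrv.1 (mem_Ioi.2 one_pos) (one_pos.trans_le hX1) hX1) hA1.le (by positivity)
    obtain ⟨x, hx, hxe⟩ := intermediate_value_Icc (zero_le_one.trans hX1) hcont hmem
    simp only at hxe
    refine ⟨x, hx.1.lt_of_ne ?_, by rw [hxe, one_div_one_div]⟩
    rintro rfl
    rw [zero_mul] at hxe
    exact (one_div_pos.2 hy).ne hxe
  exact ⟨Function.invFunOn_mem hex, Function.invFunOn_eq hex⟩

theorem tendsto_scaleInv (hA : A = fun x => ∫ t in (0 : ℝ)..x, a t)
    (h : IsTraceNormedTriple a b c) (hrv : IsRapidlyVaryingAtZero A) :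
    Tendsto (scaleInv A) atTop (𝓝[>] 0) := by
  rw [tendsto_nhdsWithin_iff]
  refine ⟨?_, (eventually_gt_atTop 0).mono fun y hy => (scaleInv_spec hA h hrv hy).1⟩
  rw [Metric.tendsto_nhds]
  intro η hη
  have hAη := hrv.2.1 η hη
  filter_upwards [eventually_gt_atTop 0, eventually_gt_atTop (1 / (η * A η))] with y hy hy'
  obtain ⟨h0, h1⟩ := scaleInv_spec hA h hrv hy
  rw [Real.dist_eq, sub_zero, abs_of_pos h0]
  by_contra! hle
  have h2 : η * A η ≤ scaleInv A y * A (scaleInv A y) :=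
    mul_le_mul hle (hrv.1 hη h0 hle) hAη.le h0.le
  rw [← h1] at hy'
  exact (one_div_le_one_div_of_le (by positivity) h2).not_gt hy'

/-- Rapid variation for the factors `1 / (1 - w⁴)` and `1 + w⁴`, with threshold `1 / w²`. Continuity
of `A` provides a point where the ratio is exactly `1 / w²`, so the mass at the wall is bounded from
above as well as from below. -/
theorem eventually_jump (hA : A = fun x => ∫ t in (0 : ℝ)..x, a t)
    (h : IsTraceNormedTriple a b c) (hrv : IsRapidlyVaryingAtZero A) {w : ℝ}
    (hw : 0 < w) (hw' : w ≤ 1 / 2) :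
    ∀ᶠ t in 𝓝[>] 0, A (t - w ^ 4 * t) ≤ w ^ 2 * A t ∧
      ∃ x, t ≤ x ∧ x ≤ t + w ^ 4 * t ∧ w ^ 2 * A x = A t := by
  have hw4 : 0 < w ^ 4 := pow_pos hw 4
  have hw41 : w ^ 4 < 1 := pow_lt_one₀ hw.le (by linarith) (by norm_num)
  have hθ : 0 < 1 - w ^ 4 := by linarith
  have hscale : Tendsto (fun t => (1 - w ^ 4) * t) (𝓝[>] 0) (𝓝[>] 0) := by
    rw [tendsto_nhdsWithin_iff]
    constructor
    · have : Tendsto (fun t => (1 - w ^ 4) * t) (𝓝 0) (𝓝 ((1 - w ^ 4) * 0)) :=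
        (continuous_const.mul continuous_id).tendsto 0
      rw [mul_zero] at this
      exact this.mono_left nhdsWithin_le_nhds
    · exact eventually_mem_nhdsWithin.mono fun t ht => mul_pos hθ ht
  have t1 := ((hrv.2.2 (1 / (1 - w ^ 4)) ((one_lt_div hθ).2 (by linarith))).comp
    hscale).eventually_ge_atTop (1 / w ^ 2)
  have t2 := (hrv.2.2 (1 + w ^ 4) (by linarith)).eventually_ge_atTop (1 / w ^ 2)
  filter_upwards [t1, t2, eventually_mem_nhdsWithin] with t h1 h2 ht
  have ht0 : 0 < t := ht
  constructor
  · have e : 1 / (1 - w ^ 4) * ((1 - w ^ 4) * t) = t := by field_simp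
    rw [Function.comp_apply, e, div_le_div_iff₀ (by positivity) (hrv.2.1 _ (mul_pos hθ ht0))] at h1
    rw [← one_sub_mul]; linarith
  · have hle : t ≤ t + w ^ 4 * t := by nlinarith
    have hcont : ContinuousOn (fun x => w ^ 2 * A x) (Icc t (t + w ^ 4 * t)) := by
      rw [hA]
      exact continuousOn_const.mul ((h.continuousOn_primitive (by linarith)).mono
        (Icc_subset_Icc_left ht0.le))
    have hmem : A t ∈ Icc (w ^ 2 * A t) (w ^ 2 * A (t + w ^ 4 * t)) := by
      have hAt := hrv.2.1 t ht0
      refine ⟨by nlinarith, ?_⟩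
      rw [div_le_div_iff₀ (by positivity) hAt, one_add_mul] at h2
      linarith
    obtain ⟨x, hx, hxe⟩ := intermediate_value_Icc hle hcont hmem
    exact ⟨x, hx.1, hx.2, hxe⟩

theorem scaleFun_pos (hA : A = fun x => ∫ t in (0 : ℝ)..x, a t)
    (h : IsTraceNormedTriple a b c) (hrv : IsRapidlyVaryingAtZero A) {r : ℝ}
    (hr : 0 < r) : 0 < scaleFun A r :=
  mul_pos hr (scaleInv_spec hA h hrv (pow_pos hr 2)).1

/-- The initial values of solutions of finite energy for large spectral parameter. -/
theorem eventually_norm_initial_le (hA : A = fun x => ∫ t in (0 : ℝ)..x, a t)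
    (h : IsTraceNormedTriple a b c) (hrv : IsRapidlyVaryingAtZero A)
    {R k ε : ℝ} (hR : 0 ≤ R) (hk : 0 < k) (hε : 0 < ε) :
    ∀ᶠ r : ℝ in atTop, ∀ μ : ℂ, ‖μ‖ ≤ R → k ^ 2 ≤ |μ.im| → ∀ u v : ℝ → ℂ,
      IsSolution a b c (r * μ) u v → IntegrableOn (energy a b c u v) (Ici 0) →
      ‖u 0 + μ * (scaleFun A r : ℂ) * v 0‖ ≤ ε * (‖u 0‖ + scaleFun A r * ‖v 0‖) := by
  have hB := boundConst_pos hR hk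
  -- Chosen before `r`, from `R`, `k` and `ε` alone; this gives uniformity in `μ` and in the
  -- solution.
  set w := min (1 / 2) (ε / boundConst R k) with hw
  have hw0 : 0 < w := lt_min (by norm_num) (by positivity)
  have hwB : w * boundConst R k ≤ ε := (le_div_iff₀ hB).1 (min_le_right _ _)
  have hx := ((tendsto_scaleInv hA h hrv).comp (tendsto_pow_atTop two_ne_zero)).eventually
    (eventually_jump hA h hrv hw0 (min_le_left _ _))
  filter_upwards [hx, eventually_gt_atTop 0] with r ⟨h1, x₁, h2, h3, h4⟩ hr μ hμ hμk u v hs hq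
  simp only [Function.comp_apply] at h1 h2 h3 h4
  obtain ⟨hx0, hxe⟩ := scaleInv_spec hA h hrv (pow_pos hr 2)
  have hA0 := hrv.2.1 _ hx0
  have key := hs.norm_initial_le (A₀ := A (scaleInv A (r ^ 2))) h hq hr hμ hk hμk
    (by rw [mul_assoc]; nth_rw 1 [← hxe]; field_simp) hx0 (by simp only [hA]) hw0
    (min_le_left _ _) (by simpa only [hA] using h1) h2 h3 (by simpa only [hA] using h4)
  refine key.trans (mul_le_mul_of_nonneg_right hwB ?_)
  positivity

end IsTraceNormedTriple

end

/-! ### From the matrix formulation to scalar solutions -/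

theorem IsHamiltonian.isTraceNormedTriple {H : ℝ → Matrix (Fin 2) (Fin 2) ℝ}
    (hH : IsHamiltonian H) (htr : IsTraceNormed H) :
    IsTraceNormedTriple (fun x => H x 0 0) (fun x => H x 0 1) (fun x => H x 1 1) where
  fst := hH.locallyIntegrable 0 0
  mid := hH.locallyIntegrable 0 1
  snd := hH.locallyIntegrable 1 1
  bounds := by
    filter_upwards [hH.posSemidef, htr] with x hx hx1
    have hdet := hx.det_nonneg
    have hsymm : H x 1 0 = H x 0 1 := by simpa using hx.1.apply 0 1
    rw [Matrix.det_fin_two, hsymm] at hdet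
    rw [Matrix.trace_fin_two] at hx1
    exact ⟨hx.diag_nonneg, hx.diag_nonneg, by linarith, hx1⟩

/-- The solution with initial value `(1, m)` provided by the `m`-function. -/
theorem IsMFunction.exists_isSolution {H : ℝ → Matrix (Fin 2) (Fin 2) ℝ} {m : ℂ → ℂ}
    (hH : IsHamiltonian H) (hm : IsMFunction H m) {z : ℂ} (hz : z.im ≠ 0) :
    ∃ u v : ℝ → ℂ, IsSolution (fun x => H x 0 0) (fun x => H x 0 1) (fun x => H x 1 1) z u v ∧
      u 0 = 1 ∧ v 0 = m z ∧
      IntegrableOn (energy (fun x => H x 0 0) (fun x => H x 0 1) (fun x => H x 1 1) u v)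
        (Ici 0) := by
  obtain ⟨U, hU, hL2⟩ := hm
  obtain ⟨hcont, h0, heq⟩ := hU z
  have hsymm : ∀ᵐ x ∂volume.restrict (Ici (0 : ℝ)), H x 1 0 = H x 0 1 :=
    hH.posSemidef.mono fun x hx => by simpa using hx.1.apply 0 1
  have cU : ∀ i j, ContinuousOn (fun x => U z x i j) (Ici 0) := fun i j =>
    (continuous_apply_apply i j).comp_continuousOn hcont
  have int : ∀ i j k l {x : ℝ}, 0 ≤ x →
      IntervalIntegrable (fun t => (H t i j : ℂ) * U z t k l) volume 0 x := fun i j k l x hx =>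
    intervalIntegrable_ofReal_mul (hH.locallyIntegrable i j) (cU k l) le_rfl hx
  -- Combines the columns of `U` with weights `1` and `m z`. Both off-diagonal entries of `H` are
  -- kept here, since they agree only almost everywhere.
  have row : ∀ i x, 0 ≤ x →
      ((J * U z x) i 0 + m z * (J * U z x) i 1) - ((J * U z 0) i 0 + m z * (J * U z 0) i 1)
        = z * ∫ t in (0 : ℝ)..x, ((H t i 0 : ℂ) * (U z t 0 0 + m z * U z t 0 1)
          + H t i 1 * (U z t 1 0 + m z * U z t 1 1)) := by
    intro i x hx
    have e : ∀ j, ∫ t in (0 : ℝ)..x, (toComplex (H t) * U z t) i j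
        = ∫ t in (0 : ℝ)..x, ((H t i 0 : ℂ) * U z t 0 j + H t i 1 * U z t 1 j) := fun j => by
      simp [Matrix.mul_apply, toComplex]
    have i0 : ∀ j, IntervalIntegrable (fun t => (H t i 0 : ℂ) * U z t 0 j + H t i 1 * U z t 1 j)
        volume 0 x := fun j => (int i 0 0 j hx).add (int i 1 1 j hx)
    have e2 : ∫ t in (0 : ℝ)..x, ((H t i 0 : ℂ) * (U z t 0 0 + m z * U z t 0 1)
          + H t i 1 * (U z t 1 0 + m z * U z t 1 1))
        = (∫ t in (0 : ℝ)..x, ((H t i 0 : ℂ) * U z t 0 0 + H t i 1 * U z t 1 0))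
          + m z * ∫ t in (0 : ℝ)..x, ((H t i 0 : ℂ) * U z t 0 1 + H t i 1 * U z t 1 1) := by
      rw [← intervalIntegral.integral_const_mul,
        ← intervalIntegral.integral_add (i0 0) ((i0 1).const_mul _)]
      congr 1; funext t; ring
    rw [e2, ← e, ← e, mul_add, mul_left_comm, ← heq x hx, ← heq x hx]
    ring
  refine ⟨fun x => U z x 0 0 + m z * U z x 0 1, fun x => U z x 1 0 + m z * U z x 1 1,
    ⟨(cU 0 0).add (continuousOn_const.mul (cU 0 1)), (cU 1 0).add (continuousOn_const.mul (cU 1 1)),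
      fun x hx => ?_, fun x hx => ?_⟩, by simp [h0], by simp [h0], ?_⟩
  · have h1 := row 1 x hx
    simp only [J, Matrix.mul_apply, Fin.sum_univ_two, Matrix.of_apply, Matrix.cons_val_zero,
      Matrix.cons_val_one, Matrix.cons_val', Matrix.cons_val_fin_one, one_mul, zero_mul,
      add_zero] at h1
    rw [h1]
    congr 1
    refine intervalIntegral.integral_congr_ae_restrict ?_
    rw [uIoc_of_le hx]
    filter_upwards [ae_restrict_of_ae_restrict_of_subset
      (fun t ht => ht.1.le : Ioc 0 x ⊆ Ici (0 : ℝ)) hsymm] with t ht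
    rw [ht]
  · have h1 := row 0 x hx
    simp only [J, Matrix.mul_apply, Fin.sum_univ_two, Matrix.of_apply, Matrix.cons_val_zero,
      Matrix.cons_val_one, Matrix.cons_val', Matrix.cons_val_fin_one, neg_mul, one_mul, zero_mul,
      zero_add] at h1
    linear_combination -h1
  · refine (hL2 z hz).re.congr ?_
    filter_upwards [hsymm] with x hx
    simp only [energy, toComplex, Matrix.mulVec, dotProduct, Fin.sum_univ_two, Matrix.map_apply,
      Matrix.cons_val_zero, Matrix.cons_val_one, Matrix.cons_val_fin_one, Pi.star_apply, hx,
      mul_one, Complex.sq_norm, Complex.normSq_apply, RCLike.re_eq_complex_re, RCLike.star_def,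
      Complex.add_re, Complex.add_im, Complex.mul_re, Complex.mul_im, Complex.ofReal_re,
      Complex.ofReal_im, Complex.conj_re, Complex.conj_im]
    ring

/-! ### Passage to uniform convergence -/

/-- Uniform convergence on compact sets avoiding the real line, from an estimate with explicit
bounds on the modulus and the imaginary part. -/
theorem tendstoUniformlyOn_of_forall_bound {δ : ℝ → ℂ → ℂ}
    (h : ∀ R k ε : ℝ, 0 ≤ R → 0 < k → 0 < ε → ∀ᶠ r : ℝ in atTop, ∀ μ : ℂ, ‖μ‖ ≤ R →
      k ^ 2 ≤ |μ.im| → ‖δ r μ‖ < ε) {K : Set ℂ} (hK : IsCompact K) (hK' : ∀ μ ∈ K, μ.im ≠ 0) :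
    TendstoUniformlyOn δ (fun _ => 0) atTop K := by
  rw [Metric.tendstoUniformlyOn_iff]
  intro ε hε
  obtain ⟨R, hR⟩ := hK.exists_bound_of_continuousOn (f := fun μ : ℂ => μ) continuousOn_id
  obtain ⟨κ, hκ, hκK⟩ : ∃ κ > 0, ∀ μ ∈ K, κ ≤ |μ.im| :=
    hK.exists_forall_le' (f := fun μ : ℂ => |μ.im|)
      (continuous_abs.comp Complex.continuous_im).continuousOn fun μ hμ => abs_pos.2 (hK' μ hμ)
  filter_upwards [h (max R 0) (√κ) ε (le_max_right _ _) (Real.sqrt_pos.2 hκ) hε] with r hr μ hμ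
  rw [dist_zero_left]
  exact hr μ ((hR μ hμ).trans (le_max_left _ _)) (by rw [Real.sq_sqrt hκ.le]; exact hκK μ hμ)

/-- An inequality `d ≤ η (1 + d)` with small `η` forces `d` to be small. -/
theorem lt_of_le_mul_add {d κ ε : ℝ} (hκ : 0 < κ) (hε : 0 < ε)
    (h : d ≤ min (1 / 2) (ε / 4) / (1 + 1 / κ) * ((1 + 1 / κ) * (1 + d))) : d < ε := by
  have hc : 0 < 1 + 1 / κ := by positivity
  rw [← mul_assoc, div_mul_cancel₀ _ hc.ne'] at h
  have h1 : min (1 / 2) (ε / 4) ≤ 1 / 2 := min_le_left _ _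
  have h2 : min (1 / 2) (ε / 4) ≤ ε / 4 := min_le_right _ _
  -- The hypothesis yields `d ≤ ε / 4 + d / 2`.
  by_contra! hd
  nlinarith

end CanonicalSystem

end

/-! ### The two asymptotic formulas -/

theorem theorem3p10 (H : ℝ → Matrix (Fin 2) (Fin 2) ℝ) (m : ℂ → ℂ)
    (hH : CanonicalSystem.IsHamiltonian H) (htr : CanonicalSystem.IsTraceNormed H)
    (hm : CanonicalSystem.IsMFunction H m) :
    (CanonicalSystem.IsRapidlyVaryingAtZero (CanonicalSystem.intA H) →
      ∃ δ : ℝ → ℂ → ℂ,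
        (∀ r : ℝ, 0 < r → ∀ μ : ℂ, μ.im ≠ 0 →
          m (r * μ) =
            -(1 / (μ * (CanonicalSystem.scaleFun (CanonicalSystem.intA H) r : ℂ)))
              * (1 + δ r μ)) ∧
        ∀ K : Set ℂ, IsCompact K → (∀ μ ∈ K, μ.im ≠ 0) →
          TendstoUniformlyOn δ (fun _ => 0) atTop K) ∧
    (CanonicalSystem.IsRapidlyVaryingAtZero (CanonicalSystem.intC H) →
      ∃ δ : ℝ → ℂ → ℂ,
        (∀ r : ℝ, 0 < r → ∀ μ : ℂ, μ.im ≠ 0 →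
          m (r * μ) =
            μ * (CanonicalSystem.scaleFun (CanonicalSystem.intC H) r : ℂ) * (1 + δ r μ)) ∧
        ∀ K : Set ℂ, IsCompact K → (∀ μ ∈ K, μ.im ≠ 0) →
          TendstoUniformlyOn δ (fun _ => 0) atTop K) := by
  have hT := hH.isTraceNormedTriple htr
  have him : ∀ {r : ℝ} {μ : ℂ}, 0 < r → μ.im ≠ 0 → ((r : ℂ) * μ).im ≠ 0 := by
    intro r μ hr hμ
    simpa using ⟨hr.ne', hμ⟩
  have hne : ∀ {μ : ℂ}, μ.im ≠ 0 → μ ≠ 0 := by rintro μ hμ rfl; exact hμ rfl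
  have hinv : ∀ {k : ℝ} {μ : ℂ}, 0 < k → k ^ 2 ≤ |μ.im| → 1 / ‖μ‖ ≤ 1 / k ^ 2 := fun hk h =>
    one_div_le_one_div_of_le (pow_pos hk 2) (h.trans (Complex.abs_im_le_norm _))
  constructor
  · intro hrv
    set f := CanonicalSystem.scaleFun (CanonicalSystem.intA H) with hf
    have hfpos : ∀ {r : ℝ}, 0 < r → 0 < f r := fun hr => hT.scaleFun_pos rfl hrv hr
    -- The error term is obtained by solving the asserted identity for it; only its size remains to
    -- be shown.
    refine ⟨fun r μ => -1 - μ * f r * m (r * μ), fun r hr μ hμ => ?_, fun K hK hK' =>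
      CanonicalSystem.tendstoUniformlyOn_of_forall_bound (fun R k ε hR hk hε => ?_) hK hK'⟩
    · have h1 : (f r : ℂ) ≠ 0 := Complex.ofReal_ne_zero.2 (hfpos hr).ne'
      have h2 := hne hμ
      field_simp; ring
    · have hκ : (0 : ℝ) < k ^ 2 := pow_pos hk 2
      filter_upwards [eventually_gt_atTop 0, hT.eventually_norm_initial_le rfl hrv hR hk
        (show 0 < min (1 / 2) (ε / 4) / (1 + 1 / k ^ 2) by positivity)] with r hr hmain μ hμ hμk
      have hμi : μ.im ≠ 0 := abs_pos.1 (hκ.trans_le hμk)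
      have hμ0 : 0 < ‖μ‖ := norm_pos_iff.2 (hne hμi)
      obtain ⟨u, v, hs, hu0, hv0, hq⟩ := hm.exists_isSolution hH (him hr hμi)
      have h1 := hmain μ hμ hμk u v hs hq
      rw [hu0, hv0, norm_one] at h1
      change ‖1 + μ * (f r : ℂ) * m (r * μ)‖ ≤ _ * (1 + f r * ‖m (r * μ)‖) at h1
      have hd : ‖-1 - μ * f r * m (r * μ)‖ = ‖1 + μ * (f r : ℂ) * m (r * μ)‖ := by
        rw [← norm_neg]; congr 1; ring
      refine CanonicalSystem.lt_of_le_mul_add hκ hε ?_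
      rw [hd]
      set d := ‖1 + μ * (f r : ℂ) * m (r * μ)‖
      refine h1.trans (mul_le_mul_of_nonneg_left ?_ (by positivity))
      -- The bound for `d` still contains `‖m‖`, which is itself controlled by `d`; `‖μ‖ ≥ k²` then
      -- allows absorption by `lt_of_le_mul_add`.
      have h2 : ‖μ‖ * (f r * ‖m (r * μ)‖) ≤ 1 + d := by
        have h3 := norm_sub_le (1 + μ * (f r : ℂ) * m (r * μ)) 1
        rw [add_sub_cancel_left, norm_mul, norm_mul, Complex.norm_real,
          Real.norm_of_nonneg (hfpos hr).le, norm_one] at h3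
        linarith
      have hd0 : 0 ≤ d := norm_nonneg _
      have h3 : f r * ‖m (r * μ)‖ ≤ 1 / k ^ 2 * (1 + d) := by
        calc f r * ‖m (r * μ)‖ = 1 / ‖μ‖ * (‖μ‖ * (f r * ‖m (r * μ)‖)) := by field_simp
          _ ≤ 1 / k ^ 2 * (1 + d) := mul_le_mul (hinv hk hμk) h2
            (mul_nonneg hμ0.le (mul_nonneg (hfpos hr).le (norm_nonneg _))) (by positivity)
      linarith
  · intro hrv
    set f := CanonicalSystem.scaleFun (CanonicalSystem.intC H) with hf
    have hfpos : ∀ {r : ℝ}, 0 < r → 0 < f r := fun hr => hT.swap.scaleFun_pos rfl hrv hr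
    refine ⟨fun r μ => m (r * μ) / (μ * f r) - 1, fun r hr μ hμ => ?_, fun K hK hK' =>
      CanonicalSystem.tendstoUniformlyOn_of_forall_bound (fun R k ε hR hk hε => ?_) hK hK'⟩
    · have h1 : (f r : ℂ) ≠ 0 := Complex.ofReal_ne_zero.2 (hfpos hr).ne'
      have h2 := hne hμ
      field_simp; ring
    · have hκ : (0 : ℝ) < k ^ 2 := pow_pos hk 2
      filter_upwards [eventually_gt_atTop 0, hT.swap.eventually_norm_initial_le rfl hrv hR hk
        (show 0 < min (1 / 2) (ε / 4) / (1 + 1 / k ^ 2) by positivity)] with r hr hmain μ hμ hμk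
      have hμi : μ.im ≠ 0 := abs_pos.1 (hκ.trans_le hμk)
      have hμ0 : 0 < ‖μ‖ := norm_pos_iff.2 (hne hμi)
      have hf0 := hfpos hr
      obtain ⟨u, v, hs, hu0, hv0, hq⟩ := hm.exists_isSolution hH (him hr hμi)
      -- The rotated solution has the same energy and initial values `(m(rμ), -1)`.
      have h1 := hmain μ hμ hμk v (fun t => -u t) hs.swap (hq.congr (Eventually.of_forall
        fun t => by simp only [CanonicalSystem.energy, norm_neg, Complex.neg_re, Complex.neg_im]
                    ring))
      rw [hu0, hv0, norm_neg, norm_one] at h1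
      change ‖m (r * μ) + μ * (f r : ℂ) * -1‖ ≤ _ * (‖m (r * μ)‖ + f r * 1) at h1
      -- Here the relative error is wanted with respect to `μ f(r)`, so the estimate is divided by
      -- its modulus `N`.
      set N := ‖μ‖ * f r with hN
      have hN0 : 0 < N := mul_pos hμ0 hf0
      have hNn : ‖μ * (f r : ℂ)‖ = N := by
        rw [norm_mul, Complex.norm_real, Real.norm_of_nonneg hf0.le]
      have hprod : μ * (f r : ℂ) ≠ 0 := norm_pos_iff.1 (hNn ▸ hN0)
      have hd : ‖m (r * μ) + μ * (f r : ℂ) * -1‖ = N * ‖m (r * μ) / (μ * f r) - 1‖ := by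
        rw [← hNn, ← norm_mul]; rw [mul_sub, mul_div_cancel₀ _ hprod]; congr 1; ring
      refine CanonicalSystem.lt_of_le_mul_add hκ hε ?_
      rw [hd] at h1
      set d := ‖m (r * μ) / (μ * f r) - 1‖ with hdd
      have hd0 : 0 ≤ d := norm_nonneg _
      have h2 : ‖m (r * μ)‖ ≤ N * (1 + d) := by
        have h3 := norm_add_le (m (r * μ) / (μ * f r) - 1) 1
        rw [sub_add_cancel, norm_div, hNn, norm_one, div_le_iff₀ hN0] at h3
        linarith
      have h3 : f r ≤ N * (1 / k ^ 2) := by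
        calc f r = N * (1 / ‖μ‖) := by rw [hN]; field_simp
          _ ≤ N * (1 / k ^ 2) := mul_le_mul_of_nonneg_left (hinv hk hμk) hN0.le
      refine le_of_mul_le_mul_left (h1.trans ?_) hN0
      rw [mul_left_comm N]
      refine mul_le_mul_of_nonneg_left ?_ (by positivity)
      have h4 : 0 ≤ N * (1 / k ^ 2) * d := by positivity
      linarith
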